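/- Let $\Sigma_0\subset\mathbb R^3$ be a surface with unit normal $\boldsymbol n$, let $\boldsymbol\rho$ be a displacement field on $\Sigma_0$, and for small real $\epsilon$ let a subscript $\epsilon$ denote the quantity belonging to the surface displaced by $\boldsymbol x\mapsto\boldsymbol x+\epsilon\boldsymbol\rho(\boldsymbol x)$ (with the orientation carried over from $\Sigma_0$). For a surface with unit normal $\boldsymbol n$ put $\mathcal I_S=\mathcal I-\boldsymbol n\boldsymbol n$, let $\partial_{Sx_i}$ be the derivative along the tangent vector $\mathcal I_S\cdot\boldsymbol e_i$, and put $$\nabla_S f=\boldsymbol e_i\,\partial_{Sx_i}f,\qquad D_S f=\boldsymbol e_i\cdot\partial_{Sx_i}(\mathcal I_S f),\qquad D_S\cdot\Psi=\sum_{i,k}\partial_{Sx_i}\big((\mathcal I_S)_{ik}\Psi_k\big),$$ where $(\nabla_S\boldsymbol\rho)_{ij}=\partial_{Sx_i}\rho_j$ and $\nabla_S\cdot\boldsymbol\rho=\partial_{Sx_i}\rho_i$. Set $$A=\mathcal I\,(\nabla_S\cdot\boldsymbol\rho)-(\nabla_S\boldsymbol\rho)^T+(\nabla_S\boldsymbol\rho)\cdot\boldsymbol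 n\boldsymbol n .$$ (1) If $\Sigma_0$ and $\boldsymbol\rho$ are $C^1$, then at each material point $$\frac{d}{d\epsilon}\Big|_{\epsilon=0}\boldsymbol n_\epsilon=-(\nabla_S\boldsymbol\rho)\cdot\boldsymbol n ,$$ and for every regular curve $\gamma$ on $\Sigma_0$ (in particular, along the contour of a patch), with unit tangent $\boldsymbol t$, conormal $\boldsymbol n_S=\boldsymbol t\times\boldsymbol n$ and line element $d\Gamma=\|\gamma'(s)\|\,ds$, $$\frac{d}{d\epsilon}\Big|_{\epsilon=0}(\boldsymbol n_S\,d\Gamma)_\epsilon=\boldsymbol n_S\,d\Gamma\cdot A .$$ (2) Let $S_0\subset\Sigma_0$ be a patch: a union of finitely many measurable pieces, overlapping in null sets, each of which is relatively compact in a region of $\Sigma_0$ with a $C^2$ parametrisation. Let $\boldsymbol\rho$ be $C^2$ along these regions, let $\varphi$ be a $C^2$ field (scalar, vector, tensor, or with values in any real Banach space) on an open subset of $\mathbb R^3$ containing the closure of $S_0$, and let $S_\epsilon$ be the displaced patch. Then, for $\epsilon$ near $0$, $\int_{S_\epsilon}D_S\varphi\,d\Sigma$ exists, so does the integral on the right below,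 and $$\frac{d}{d\epsilon}\Big|_{\epsilon=0}\int_{S_\epsilon}D_S\varphi\,d\Sigma=\int_{S_0}D_S\cdot\big\{A\,\varphi+\mathcal I\,(\boldsymbol\rho\cdot\nabla)\varphi\big\}\,d\Sigma ,$$ that is, to first order in the displacement, $\int_{S_p}D_S\varphi\,d\Sigma=\int_{S_0}D_S\varphi\,d\Sigma+\int_{S_0}D_S\cdot\{[\mathcal I(\nabla_S\cdot\boldsymbol\rho)-(\nabla_S\boldsymbol\rho)^T+(\nabla_S\boldsymbol\rho)\cdot\boldsymbol n\boldsymbol n+\mathcal I\,\boldsymbol\rho\cdot\nabla]\varphi\}\,d\Sigma$. (3) If moreover the parametrisations are $C^3$ and $\boldsymbol\rho=\rho\,\boldsymbol n$ with a $C^2$ scalar field $\rho$ on $\Sigma_0$ (along the regions in (2)), then the integral below exists and $$\frac{d}{d\epsilon}\Big|_{\epsilon=0}\int_{S_\epsilon}D_S\varphi\,d\Sigma=\int_{S_0}D_S\cdot\big\{\big[\mathcal I\,(\rho\,\nabla_S\cdot\boldsymbol n)-\rho\,\nabla_S\boldsymbol n+(\nabla_S\rho)\,\boldsymbol n\big]\varphi+\mathcal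 I\,\rho\,(\boldsymbol n\cdot\nabla)\varphi\big\}\,d\Sigma .$$ -/

import Mathlib

open scoped Matrix Topology

noncomputable section

namespace DeformableSurface

/-- Euclidean three-space. -/
abbrev E3 := EuclideanSpace ℝ (Fin 3)

/-- The plane of curvilinear coordinates `ξ = (ξ₀, ξ₁)`. -/
abbrev P2 := EuclideanSpace ℝ (Fin 2)

/-- The vector product on `E3`. -/
def cross (u v : E3) : E3 := WithLp.toLp 2 (crossProduct u.ofLp v.ofLp)

/-- The coordinate derivative `∂f/∂ξ_α`. -/
def pd {F : Type*} [NormedAddCommGroup F] [NormedSpace ℝ F]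
    (f : P2 → F) (α : Fin 2) (ξ : P2) : F :=
  fderiv ℝ f ξ (EuclideanSpace.single α 1)

/-- `∂X/∂ξ₀ × ∂X/∂ξ₁`; it does not vanish where `X` is an immersion. -/
def areaVec (X : P2 → E3) (ξ : P2) : E3 := cross (pd X 0 ξ) (pd X 1 ξ)

/-- The boundary Jacobian `J_S`: the surface element is `dΣ = J_S dξ₀ dξ₁`. -/
def jac (X : P2 → E3) (ξ : P2) : ℝ := ‖areaVec X ξ‖

/-- The unit normal of the parametrised surface `X` at `X ξ`. -/
def unitNormal (X : P2 → E3) (ξ : P2) : E3 := (jac X ξ)⁻¹ • areaVec X ξ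

/-- The surface gradients `∇_S ξ_α` of the two coordinates, i.e. the basis of the tangent plane
dual to `∂X/∂ξ₀`, `∂X/∂ξ₁`. -/
def coordGrad (X : P2 → E3) (ξ : P2) : Fin 2 → E3 :=
  ![(jac X ξ)⁻¹ • cross (pd X 1 ξ) (unitNormal X ξ),
    (jac X ξ)⁻¹ • cross (unitNormal X ξ) (pd X 0 ξ)]

section Operators

variable {F : Type*} [NormedAddCommGroup F] [NormedSpace ℝ F]

/-- The boundary directional derivative `∂_{S x_i} f` of a field `f` on the surface, given as a
function of the coordinates: the derivative of `f` along the tangent vector `I_S · e_i`.  The vector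
with coordinates `(e_i · ∇_S ξ_α)_α` is the one that `dX` maps to `I_S · e_i`; see `sderiv_comp`. -/
def sderiv (X : P2 → E3) (f : P2 → F) (i : Fin 3) (ξ : P2) : F :=
  ∑ α : Fin 2, (coordGrad X ξ α) i • pd f α ξ

/-- The identity tensor of the surface, `I_S = I - n n`. -/
def idS (X : P2 → E3) (ξ : P2) : Matrix (Fin 3) (Fin 3) ℝ :=
  1 - Matrix.vecMulVec (unitNormal X ξ).ofLp (unitNormal X ξ).ofLp

/-- The boundary nabla operator `∇_S f = e_i ∂_{S x_i} f`.  A tensor with a leading vector index and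
remaining indices in `F` is a function `Fin 3 → F`. -/
def gradS (X : P2 → E3) (f : P2 → F) (ξ : P2) : Fin 3 → F := fun i => sderiv X f i ξ

/-- The boundary exterior differential operator `D_S f = e_i · ∂_{S x_i} (I_S f)`. -/
def DS (X : P2 → E3) (f : P2 → F) (ξ : P2) : Fin 3 → F :=
  fun j => ∑ i, sderiv X (fun η => idS X η i j • f η) i ξ

/-- `D_S · Ψ`: the contraction of the leading index of `D_S Ψ` with the leading index of `Ψ`. -/
def DSdot (X : P2 → E3) (Ψ : P2 → Fin 3 → F) (ξ : P2) : F := ∑ k, DS X Ψ ξ k k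

end Operators

theorem sum_coordGrad_smul_pd (X : P2 → E3) (ξ : P2) (hX : areaVec X ξ ≠ 0) (i : Fin 3) :
    ∑ α : Fin 2, (coordGrad X ξ α) i • pd X α ξ = WithLp.toLp 2 (idS X ξ i) := by
  have hJ : jac X ξ ≠ 0 := norm_ne_zero_iff.mpr hX
  have hJ2 : jac X ξ ^ 2 = areaVec X ξ 0 ^ 2 + areaVec X ξ 1 ^ 2 + areaVec X ξ 2 ^ 2 := by
    rw [jac, EuclideanSpace.norm_sq_eq, Fin.sum_univ_three]
    simp only [Real.norm_eq_abs, sq_abs]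
  have e0 : areaVec X ξ 0 = pd X 0 ξ 1 * pd X 1 ξ 2 - pd X 0 ξ 2 * pd X 1 ξ 1 := by
    simp [areaVec, cross, cross_apply]
  have e1 : areaVec X ξ 1 = pd X 0 ξ 2 * pd X 1 ξ 0 - pd X 0 ξ 0 * pd X 1 ξ 2 := by
    simp [areaVec, cross, cross_apply]
  have e2 : areaVec X ξ 2 = pd X 0 ξ 0 * pd X 1 ξ 1 - pd X 0 ξ 1 * pd X 1 ξ 0 := by
    simp [areaVec, cross, cross_apply]
  ext j
  fin_cases i <;> fin_cases j <;>
    simp [coordGrad, cross, cross_apply, idS, Matrix.vecMulVec_apply, unitNormal,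
      Fin.sum_univ_two] <;>
    field_simp <;> simp only [hJ2, e0, e1, e2] <;> ring

/-- For a field `f` in space, `∂_{S x_i} f` is the derivative of `f` in the direction `I_S · e_i`. -/
theorem sderiv_comp {F : Type*} [NormedAddCommGroup F] [NormedSpace ℝ F] (X : P2 → E3) (f : E3 → F)
    (ξ : P2) (i : Fin 3) (hX : areaVec X ξ ≠ 0) (hd : DifferentiableAt ℝ X ξ)
    (hf : DifferentiableAt ℝ f (X ξ)) :
    sderiv X (f ∘ X) i ξ = fderiv ℝ f (X ξ) (WithLp.toLp 2 (idS X ξ i)) := by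
  rw [← sum_coordGrad_smul_pd X ξ hX i, map_sum]
  simp [sderiv, pd, fderiv_comp ξ hf hd]

/-- `∇_S r` for a vector field `r`, as the matrix `(∇_S r)_{ij} = ∂_{S x_i} r_j`. -/
def gradSVec (X : P2 → E3) (r : P2 → E3) (ξ : P2) : Matrix (Fin 3) (Fin 3) ℝ :=
  Matrix.of fun i j => gradS X r ξ i j

/-- The surface divergence `∇_S · r`. -/
def divS (X : P2 → E3) (r : P2 → E3) (ξ : P2) : ℝ := (gradSVec X r ξ).trace

/-- The tensor `I (∇_S · r) - (∇_S r)ᵀ + (∇_S r) · n n`. -/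
def varTensor (X : P2 → E3) (r : P2 → E3) (ξ : P2) : Matrix (Fin 3) (Fin 3) ℝ :=
  divS X r ξ • (1 : Matrix (Fin 3) (Fin 3) ℝ) - (gradSVec X r ξ)ᵀ
    + Matrix.vecMulVec (gradSVec X r ξ *ᵥ (unitNormal X ξ).ofLp) (unitNormal X ξ).ofLp

/-- The tensor `I (h ∇_S · n) - h ∇_S n + (∇_S h) n` for a scalar field `h`. -/
def varTensorNormal (X : P2 → E3) (h : P2 → ℝ) (ξ : P2) : Matrix (Fin 3) (Fin 3) ℝ :=
  (h ξ * divS X (unitNormal X) ξ) • (1 : Matrix (Fin 3) (Fin 3) ℝ)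
    - h ξ • gradSVec X (unitNormal X) ξ
    + Matrix.vecMulVec (gradS X h ξ) (unitNormal X ξ).ofLp

/-- The parametrised surface `X` after the displacement `x ↦ x + ε ρ(x)`. -/
def displace (X : P2 → E3) (ρ : E3 → E3) (ε : ℝ) : P2 → E3 := fun ξ => X ξ + ε • ρ (X ξ)

/-- The field `[A + I (ρ · ∇)] φ` on the surface `X`, where `A` is a field of second order tensors
and `(ρ · ∇) φ` is the ordinary directional derivative of `φ` in space. -/
def firstOrderField {F : Type*} [NormedAddCommGroup F] [NormedSpace ℝ F] (X : P2 → E3)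
    (A : P2 → Matrix (Fin 3) (Fin 3) ℝ) (ρ : E3 → E3) (φ : E3 → F) : P2 → Fin 3 → Fin 3 → F :=
  fun ξ k l => A ξ k l • φ (X ξ)
    + (1 : Matrix (Fin 3) (Fin 3) ℝ) k l • fderiv ℝ φ (X ξ) (ρ (X ξ))

/-- For a contour `γ = X ∘ c` on the surface: `n_S dΓ = n_S ‖γ'(s)‖ ds` (without the factor `ds`),
where `n_S = t × n` and `t = γ' / ‖γ'‖`.  If `γ` runs along the contour of a patch so
that `t = n × n_S` for the outer `n_S`, this is the outer normal line element. -/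
def normalLineElement (X : P2 → E3) (c : ℝ → P2) (s : ℝ) : E3 :=
  ‖deriv (X ∘ c) s‖ • cross (‖deriv (X ∘ c) s‖⁻¹ • deriv (X ∘ c) s) (unitNormal X (c s))

/-- `X : U → Sig` is a regular `C^r` parametrisation of a relatively open part of the set `Sig`
(a homeomorphism onto it), and it induces the unit normal `n`. -/
structure IsLocalParam (r : WithTop ℕ∞) (Sig : Set E3) (n : E3 → E3) (U : Set P2)
    (X : P2 → E3) : Prop where
  isOpen_dom : IsOpen U
  contDiffOn : ContDiffOn ℝ r X U
  immersion : ∀ ξ ∈ U, LinearIndependent ℝ ![pd X 0 ξ, pd X 1 ξ]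
  injOn : Set.InjOn X U
  isOpen_image : ∀ V ⊆ U, IsOpen V → ∃ W : Set E3, IsOpen W ∧ X '' V = Sig ∩ W
  normal_eq : ∀ ξ ∈ U, unitNormal X ξ = n (X ξ)

/-- A patch of the boundary `Sig` with unit normal `n`: a union of finitely many pieces `X_k(K_k)`,
overlapping at most in null sets, where `X_k` is a local `C²` parametrisation of `Sig` and `K_k` is
measurable and relatively compact in the domain of `X_k`. -/
structure Patch (Sig : Set E3) (n : E3 → E3) where
  m : ℕ
  U : Fin m → Set P2
  X : Fin m → P2 → E3
  K : Fin m → Set P2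
  isLocalParam : ∀ k, IsLocalParam 2 Sig n (U k) (X k)
  measurable : ∀ k, MeasurableSet (K k)
  isCompact_closure : ∀ k, IsCompact (closure (K k))
  closure_subset : ∀ k, closure (K k) ⊆ U k
  overlap_null : ∀ k l, k ≠ l → MeasureTheory.volume {ξ ∈ K k | X k ξ ∈ X l '' K l} = 0

namespace Patch

variable {Sig : Set E3} {n : E3 → E3}

/-- The set of points of a patch. -/
def carrier (S : Patch Sig n) : Set E3 := ⋃ k, S.X k '' S.K k

/-- `∫ f dΣ` over the surface with the pieces `Y_k(K_k)`; the field `f` is given on the `k`-th piece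
as the function `f_k` of the coordinates. -/
def surfIntegral (S : Patch Sig n) {G : Type*} [NormedAddCommGroup G] [NormedSpace ℝ G]
    (Y : Fin S.m → P2 → E3) (f : Fin S.m → P2 → G) : G :=
  ∑ k, ∫ ξ in S.K k, jac (Y k) ξ • f k ξ

/-- The integral `surfIntegral` exists. -/
def SurfIntegrable (S : Patch Sig n) {G : Type*} [NormedAddCommGroup G] [NormedSpace ℝ G]
    (Y : Fin S.m → P2 → E3) (f : Fin S.m → P2 → G) : Prop :=
  ∀ k, MeasureTheory.IntegrableOn (fun ξ => jac (Y k) ξ • f k ξ) (S.K k)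

/-- `D_S φ` on the patch displaced by `ε ρ`, for a field `φ` in space. -/
def displacedDS (S : Patch Sig n) {F : Type*} [NormedAddCommGroup F] [NormedSpace ℝ F]
    (ρ : E3 → E3) (φ : E3 → F) (ε : ℝ) : Fin S.m → P2 → Fin 3 → F :=
  fun k => DS (displace (S.X k) ρ ε) (φ ∘ displace (S.X k) ρ ε)

end Patch

end DeformableSurface

end

/-!
# First variation of the integral of `D_S φ` over a patch

In coordinates the operator `D_S` has the divergence form
`J_S D_S f = ∑_α ∂_α (b_α f)` with `b_α = J_S ∇_S ξ_α` (`jac_smul_DS`).  Two facts give this: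
`b_α` is tangential, and `∑_α ∂_α b_α` is normal (`sum_pd_scaledGrad_mul_idS`).  The vectors `b_α`
are `∂₁X × n` and `n × ∂₀X`, that is, up to sign they are the vectors `n_S dΓ` of the coordinate
lines.

For a tangent vector `τ` carried along with the surface, the variation of `τ × n` is
`(τ × n) · A` (`hasDerivAt_cross_nu`, with the algebra in `dyad_variation`).  Applied to the tangent
of a curve this is the variation of the line element; applied to the coordinate lines it gives
`d/dε (b_α φ) = b_α · {A φ + I (ρ · ∇) φ}` (`fderiv_flux_jet`).  Exchanging `d/dε` with `∂_α` and
with the integral over the fixed coordinate domain therefore yields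
`∑_α ∂_α (b_α · {A φ + I (ρ · ∇) φ})`, which is `J_S D_S · {A φ + I (ρ · ∇) φ}` by the divergence
form read backwards.

The exchange (`hasDerivAt_integral_pd`) needs care about smoothness: `b_α` contains first
derivatives of `X` and is only `C¹` in `ξ`.  However, `b_α φ` on the displaced surface is a `C²`
function `flux` of `ε` and of the `C¹` data `jet`, so that second derivatives are only taken of
`flux`, where they commute.  Compactness of the closure of a piece provides the uniform bounds.

For a normal displacement `h n`, symmetry of `∇_S n` shows that `A` differs from the tensor of the
special formula by `n ∇_S h` only (`varTensor_normal`).  As `b_α · n = 0`, this dyad does not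
contribute to `D_S ·`.
-/

open scoped Matrix Topology

noncomputable section

namespace DeformableSurface

/-! ### Vector algebra in `E3` -/

theorem inner_E3 (u v : E3) : inner ℝ u v = u 0 * v 0 + u 1 * v 1 + u 2 * v 2 := by
  simp [PiLp.inner_apply, Fin.sum_univ_three]; ring

theorem cross_zero (u v : E3) : cross u v 0 = u 1 * v 2 - u 2 * v 1 := by
  simp [cross, cross_apply]

theorem cross_one (u v : E3) : cross u v 1 = u 2 * v 0 - u 0 * v 2 := by
  simp [cross, cross_apply]

theorem cross_two (u v : E3) : cross u v 2 = u 0 * v 1 - u 1 * v 0 := by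
  simp [cross, cross_apply]

theorem cross_smul_right (t : ℝ) (u v : E3) : cross u (t • v) = t • cross u v := by
  ext j; fin_cases j <;> simp [cross_zero, cross_one, cross_two] <;> ring

theorem cross_smul_left (t : ℝ) (u v : E3) : cross (t • u) v = t • cross u v := by
  ext j; fin_cases j <;> simp [cross_zero, cross_one, cross_two] <;> ring

theorem cross_add_left (u v w : E3) : cross (u + v) w = cross u w + cross v w := by
  ext j; fin_cases j <;> simp [cross_zero, cross_one, cross_two] <;> ring

theorem cross_add_right (u v w : E3) : cross u (v + w) = cross u v + cross u w := by
  ext j; fin_cases j <;> simp [cross_zero, cross_one, cross_two] <;> ring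

theorem cross_anticomm (u v : E3) : cross u v = -cross v u := by
  ext j; fin_cases j <;> simp [cross_zero, cross_one, cross_two] <;> ring

theorem inner_cross_left_self (u v : E3) : inner ℝ u (cross u v) = 0 := by
  rw [inner_E3, cross_zero, cross_one, cross_two]; ring

theorem inner_cross_right_self (u v : E3) : inner ℝ v (cross u v) = 0 := by
  rw [inner_E3, cross_zero, cross_one, cross_two]; ring

/-- The tangential part of a vector product: only the normal components of the factors
contribute to it. -/
theorem cross_sub_normal_part {n : E3} (hn : inner ℝ n n = (1 : ℝ)) (u v : E3) :
    cross u v - inner ℝ n (cross u v) • n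
      = inner ℝ u n • cross n v - inner ℝ v n • cross n u := by
  rw [inner_E3] at hn
  simp only [inner_E3, cross_zero, cross_one, cross_two]
  ext j
  fin_cases j <;> simp [cross_zero, cross_one, cross_two]
  · linear_combination (-(u 1 * v 2 - u 2 * v 1)) * hn
  · linear_combination (-(u 2 * v 0 - u 0 * v 2)) * hn
  · linear_combination (-(u 0 * v 1 - u 1 * v 0)) * hn

/-- The algebraic core of the variation of `n_S dΓ`, for the dyad `∇_S r = g r` with tangential
`g`: the vector `τ · g r × n - τ × (g r · n)` equals `(τ × n) · A`. -/
theorem dyad_variation {n τ g : E3} (hn : inner ℝ n n = (1 : ℝ)) (hτ : inner ℝ τ n = (0 : ℝ))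
    (hg : inner ℝ g n = (0 : ℝ)) (r : E3) :
    (inner ℝ τ g : ℝ) • cross r n - (inner ℝ r n : ℝ) • cross τ g
      = (inner ℝ g r : ℝ) • cross τ n - (inner ℝ (cross τ n) r : ℝ) • g
        + ((inner ℝ (cross τ n) g : ℝ) * inner ℝ r n) • n := by
  have h := cross_sub_normal_part hn τ g
  rw [hτ, hg, zero_smul, zero_smul, sub_zero, sub_eq_zero] at h
  have h0 := congrArg (fun v : E3 => v 0) h
  have h1 := congrArg (fun v : E3 => v 1) h
  have h2 := congrArg (fun v : E3 => v 2) h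
  simp only [inner_E3, cross_zero, cross_one, cross_two, PiLp.smul_apply, smul_eq_mul]
    at h0 h1 h2 hn hτ hg ⊢
  ext j
  fin_cases j <;> simp [cross_zero, cross_one, cross_two]
  · linear_combination (-(r 0 * n 0 + r 1 * n 1 + r 2 * n 2)) * h0
      + (r 1 * τ 2 - r 2 * τ 1) * hg
  · linear_combination (-(r 0 * n 0 + r 1 * n 1 + r 2 * n 2)) * h1
      + (r 2 * τ 0 - r 0 * τ 2) * hg
  · linear_combination (-(r 0 * n 0 + r 1 * n 1 + r 2 * n 2)) * h2
      + (r 0 * τ 1 - r 1 * τ 0) * hg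

/-- The vector product as a continuous bilinear map. -/
def crossL : E3 →L[ℝ] E3 →L[ℝ] E3 :=
  LinearMap.toContinuousBilinearMap
    (LinearMap.mk₂ ℝ cross cross_add_left cross_smul_left cross_add_right cross_smul_right)

theorem crossL_apply (u v : E3) : crossL u v = cross u v := rfl

theorem _root_.HasDerivAt.cross {u v : ℝ → E3} {u' v' : E3} {t : ℝ} (hu : HasDerivAt u u' t)
    (hv : HasDerivAt v v' t) :
    HasDerivAt (fun s => cross (u s) (v s)) (cross (u t) v' + cross u' (v t)) t :=
  crossL.hasDerivAt_of_bilinear (fun _ => hu) (fun _ => hv)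

theorem _root_.ContDiffAt.cross {V : Type*} [NormedAddCommGroup V] [NormedSpace ℝ V]
    {u v : V → E3} {x : V} {r : WithTop ℕ∞} (hu : ContDiffAt ℝ r u x) (hv : ContDiffAt ℝ r v x) :
    ContDiffAt ℝ r (fun y => cross (u y) (v y)) x :=
  ContDiffAt.comp (g := fun z : E3 × E3 => crossL z.1 z.2) x
    crossL.isBoundedBilinearMap.contDiff.contDiffAt (hu.prodMk hv)

theorem pd_cross {u v : P2 → E3} {ξ : P2} (hu : DifferentiableAt ℝ u ξ)
    (hv : DifferentiableAt ℝ v ξ) (α : Fin 2) :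
    pd (fun η => cross (u η) (v η)) α ξ = cross (u ξ) (pd v α ξ) + cross (pd u α ξ) (v ξ) := by
  have := crossL.fderiv_of_bilinear hu hv
  simp only [crossL_apply] at this
  simp [pd, this, crossL_apply]

/-- The unit vector along `p × q`. -/
def nu (p q : E3) : E3 := ‖cross p q‖⁻¹ • cross p q

theorem inner_nu_self {p q : E3} (h : cross p q ≠ 0) : inner ℝ (nu p q) (nu p q) = (1 : ℝ) := by
  have : ‖cross p q‖ ≠ 0 := norm_ne_zero_iff.mpr h
  rw [nu, real_inner_smul_left, real_inner_smul_right, real_inner_self_eq_norm_sq]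
  field_simp

theorem inner_left_nu (p q : E3) : inner ℝ p (nu p q) = (0 : ℝ) := by
  rw [nu, real_inner_smul_right, inner_cross_left_self, mul_zero]

theorem inner_right_nu (p q : E3) : inner ℝ q (nu p q) = (0 : ℝ) := by
  rw [nu, real_inner_smul_right, inner_cross_right_self, mul_zero]

theorem norm_smul_nu {p q : E3} (h : cross p q ≠ 0) : ‖cross p q‖ • nu p q = cross p q := by
  rw [nu, smul_smul, mul_inv_cancel₀ (norm_ne_zero_iff.mpr h), one_smul]

theorem contDiffAt_nu {V : Type*} [NormedAddCommGroup V] [NormedSpace ℝ V]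
    {u v : V → E3} {x : V} {r : WithTop ℕ∞} (hu : ContDiffAt ℝ r u x) (hv : ContDiffAt ℝ r v x)
    (h : cross (u x) (v x) ≠ 0) : ContDiffAt ℝ r (fun y => nu (u y) (v y)) x :=
  (((hu.cross hv).norm ℝ h).inv (norm_ne_zero_iff.mpr h)).smul (hu.cross hv)

/-- The variation of a unit vector is the tangential part of the variation of the vector. -/
theorem hasDerivAt_normalize {a : ℝ → E3} {a' : E3} {t : ℝ} (ha : HasDerivAt a a' t)
    (h0 : a t ≠ 0) :
    HasDerivAt (fun s => ‖a s‖⁻¹ • a s)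
      (‖a t‖⁻¹ • (a' - inner ℝ (‖a t‖⁻¹ • a t) a' • (‖a t‖⁻¹ • a t))) t := by
  have hN : ‖a t‖ ≠ 0 := norm_ne_zero_iff.mpr h0
  have h1 : HasDerivAt (fun s => ‖a s‖) (2 * inner ℝ (a t) a' / (2 * √(‖a t‖ ^ 2))) t := by
    simpa [Real.sqrt_sq] using ha.norm_sq.sqrt (pow_ne_zero 2 hN)
  rw [Real.sqrt_sq (norm_nonneg _)] at h1
  refine ((h1.inv hN).smul ha).congr_deriv ?_
  symm
  rw [real_inner_smul_left, smul_sub, smul_smul, smul_smul, sub_eq_add_neg, add_comm, ← neg_smul,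
    add_comm]
  simp only [Pi.inv_apply]
  congr 2
  field_simp

theorem hasDerivAt_nu {p q : E3} (h : cross p q ≠ 0) (p' q' : E3) :
    HasDerivAt (fun ε : ℝ => nu (p + ε • p') (q + ε • q'))
      (-(‖cross p q‖⁻¹ • ((inner ℝ p' (nu p q) : ℝ) • cross q (nu p q)
        + (inner ℝ q' (nu p q) : ℝ) • cross (nu p q) p))) 0 := by
  have hl : ∀ u v : E3, HasDerivAt (fun ε : ℝ => u + ε • v) v 0 := fun u v => by
    simpa using ((hasDerivAt_id (0 : ℝ)).smul_const v).const_add u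
  have hd := hasDerivAt_normalize ((hl p p').cross (hl q q')) (by simpa using h)
  simp only [zero_smul, add_zero] at hd
  refine hd.congr_deriv ?_
  symm
  change _ = ‖cross p q‖⁻¹ • (_ - inner ℝ (nu p q) _ • nu p q)
  rw [← smul_neg]
  congr 1
  have e1 := cross_sub_normal_part (inner_nu_self h) p q'
  have e2 := cross_sub_normal_part (inner_nu_self h) p' q
  rw [inner_left_nu, zero_smul, zero_sub] at e1
  rw [inner_right_nu, zero_smul, sub_zero] at e2
  rw [inner_add_right, add_smul, add_sub_add_comm, e1, e2, cross_anticomm q]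
  module

/-! ### Differentiation under the integral sign -/

variable {F : Type*} [NormedAddCommGroup F] [NormedSpace ℝ F]

theorem _root_.ContDiffOn.pd {f : P2 → F} {U : Set P2} {m r : WithTop ℕ∞} (hf : ContDiffOn ℝ r f U)
    (hU : IsOpen U) (h : m + 1 ≤ r) (α : Fin 2) : ContDiffOn ℝ m (pd f α) U :=
  (hf.fderiv_of_isOpen hU h).clm_apply contDiffOn_const

theorem _root_.ContDiffAt.pd {f : P2 → F} {ξ : P2} {m r : WithTop ℕ∞} (hf : ContDiffAt ℝ r f ξ)
    (h : m + 1 ≤ r) (α : Fin 2) : ContDiffAt ℝ m (pd f α) ξ :=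
  (hf.fderiv_right h).clm_apply contDiffAt_const

theorem pd_pd_comm {f : P2 → F} {ξ : P2} (hf : ContDiffAt ℝ 2 f ξ) (α β : Fin 2) :
    pd (pd f α) β ξ = pd (pd f β) α ξ := by
  have hd : DifferentiableAt ℝ (fderiv ℝ f) ξ :=
    (hf.fderiv_right (m := 1) (by norm_num)).differentiableAt (by norm_num)
  have key : ∀ a b : Fin 2, pd (pd f a) b ξ
      = fderiv ℝ (fderiv ℝ f) ξ (EuclideanSpace.single b 1) (EuclideanSpace.single a 1) := by
    intro a b
    have := fderiv_clm_apply hd (differentiableAt_const (EuclideanSpace.single a (1 : ℝ)))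
    change fderiv ℝ (fun η => fderiv ℝ f η (EuclideanSpace.single a 1)) ξ _ = _
    rw [this]; simp
  rw [key, key]
  exact hf.isSymmSndFDerivAt (by simp) _ _

/-- If the dependence on `ε` and on the `C¹` data `w` is jointly `C²`, then
`d/dε ∫ ∂_α Φ(ε, w) = ∫ ∂_α (∂_ε Φ)(0, w)`.  Second derivatives are taken of `Φ` only, so that
one derivative of `w` suffices. -/
theorem hasDerivAt_integral_pd {V : Type*} [NormedAddCommGroup V] [NormedSpace ℝ V]
    {Φ : ℝ × V → F} {O : Set (ℝ × V)} (hO : IsOpen O) (hΦ : ContDiffOn ℝ 2 Φ O)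
    {w : P2 → V} {U C K : Set P2} (hU : IsOpen U) (hw : ContDiffOn ℝ 1 w U) (hC : IsCompact C)
    (hCU : C ⊆ U) (hCO : ∀ ξ ∈ C, ((0 : ℝ), w ξ) ∈ O) (hK : MeasurableSet K) (hKC : K ⊆ C)
    (α : Fin 2) :
    (∀ᶠ ε : ℝ in 𝓝 0, MeasureTheory.IntegrableOn (pd (fun η => Φ (ε, w η)) α) K) ∧
    MeasureTheory.IntegrableOn (pd (fun η => fderiv ℝ Φ (0, w η) (1, 0)) α) K ∧
    HasDerivAt (fun ε : ℝ => ∫ ξ in K, pd (fun η => Φ (ε, w η)) α ξ)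
      (∫ ξ in K, pd (fun η => fderiv ℝ Φ (0, w η) (1, 0)) α ξ) 0 := by
  have hΦ1 : ContDiffOn ℝ 1 (fderiv ℝ Φ) O := hΦ.fderiv_of_isOpen hO (by norm_num)
  have hΦ2 : ContinuousOn (fderiv ℝ (fderiv ℝ Φ)) O :=
    (hΦ1.fderiv_of_isOpen hO (m := 0) (by norm_num)).continuousOn
  have hwd : ∀ ξ ∈ U, HasFDerivAt w (fderiv ℝ w ξ) ξ := fun ξ hξ =>
    ((hw.contDiffAt (hU.mem_nhds hξ)).differentiableAt (by norm_num)).hasFDerivAt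
  have hwc : ContinuousOn (pd w α) U := (hw.pd hU (m := 0) (by norm_num) α).continuousOn
  -- the chain rule in `ξ`
  have hpd : ∀ ε : ℝ, ∀ ξ ∈ C, (ε, w ξ) ∈ O →
      pd (fun η => Φ (ε, w η)) α ξ = fderiv ℝ Φ (ε, w ξ) (0, pd w α ξ) := by
    intro ε ξ hξ ho
    have h1 : HasFDerivAt Φ (fderiv ℝ Φ (ε, w ξ)) (ε, w ξ) :=
      ((hΦ.contDiffAt (hO.mem_nhds ho)).differentiableAt (by norm_num)).hasFDerivAt
    have h2 := (hasFDerivAt_const ε ξ).prodMk (hwd ξ (hCU hξ))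
    have h3 := (h1.comp ξ h2).fderiv
    change fderiv ℝ (Φ ∘ fun η => (ε, w η)) ξ _ = _
    rw [h3]; rfl
  have hd1 : ∀ z ∈ O, HasFDerivAt (fderiv ℝ Φ) (fderiv ℝ (fderiv ℝ Φ) z) z := fun z hz =>
    ((hΦ1.contDiffAt (hO.mem_nhds hz)).differentiableAt (by norm_num)).hasFDerivAt
  set D : ℝ → P2 → F := fun ε ξ =>
    fderiv ℝ (fderiv ℝ Φ) (ε, w ξ) (1, 0) (0, pd w α ξ) with hD
  have hpd' : ∀ ξ ∈ C, pd (fun η => fderiv ℝ Φ (0, w η) (1, 0)) α ξ = D 0 ξ := by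
    intro ξ hξ
    have h2 := (hasFDerivAt_const (0 : ℝ) ξ).prodMk (hwd ξ (hCU hξ))
    have h3 := (((hd1 _ (hCO ξ hξ)).comp ξ h2).clm_apply
      (hasFDerivAt_const ((1 : ℝ), (0 : V)) ξ)).fderiv
    have h4 : IsSymmSndFDerivAt ℝ Φ (0, w ξ) :=
      (hΦ.contDiffAt (hO.mem_nhds (hCO ξ hξ))).isSymmSndFDerivAt (by simp)
    change fderiv ℝ (fun η => (fderiv ℝ Φ ∘ fun η => ((0 : ℝ), w η)) η (1, 0)) ξ _ = _
    rw [h3, hD]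
    simp only [ContinuousLinearMap.comp_zero, zero_add, ContinuousLinearMap.flip_apply]
    exact h4 _ _
  have hpair : ∀ ε : ℝ, ContinuousOn (fun ξ => (ε, w ξ)) C := fun ε =>
    continuousOn_const.prodMk (hw.continuousOn.mono hCU)
  have hdir : ContinuousOn (fun ξ => ((0 : ℝ), pd w α ξ)) C :=
    continuousOn_const.prodMk (hwc.mono hCU)
  have hD0 : ContinuousOn (D 0) C :=
    ((hΦ2.comp (hpair 0) hCO).clm_apply continuousOn_const).clm_apply hdir
  obtain ⟨M, hM⟩ := hC.exists_bound_of_continuousOn hD0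
  -- a neighbourhood of `ε = 0` that is uniform in `ξ ∈ C`
  have hev : ∀ᶠ ε : ℝ in 𝓝 0, ∀ ξ ∈ C, (ε, w ξ) ∈ O ∧ ‖D ε ξ‖ < M + 1 := by
    refine hC.eventually_forall_of_forall_eventually
      (P := fun ε ξ => (ε, w ξ) ∈ O ∧ ‖D ε ξ‖ < M + 1) fun ξ hξ => ?_
    have hξU := hU.mem_nhds (hCU hξ)
    have c1 : ContinuousAt (fun z : ℝ × P2 => (z.1, w z.2)) (0, ξ) :=
      continuousAt_fst.prodMk
        (ContinuousAt.comp (f := Prod.snd) (hw.continuousOn.continuousAt hξU) continuousAt_snd)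
    have c2 : ContinuousAt (fun z : ℝ × P2 => ((0 : ℝ), pd w α z.2)) (0, ξ) :=
      continuousAt_const.prodMk
        (ContinuousAt.comp (f := Prod.snd) (hwc.continuousAt hξU) continuousAt_snd)
    have c3 : ContinuousAt (fun z : ℝ × P2 => D z.1 z.2) (0, ξ) :=
      ((ContinuousAt.comp (f := fun z : ℝ × P2 => (z.1, w z.2))
        (hΦ2.continuousAt (hO.mem_nhds (hCO ξ hξ))) c1).clm_apply continuousAt_const).clm_apply c2
    have hlt : ‖D 0 ξ‖ < M + 1 := by linarith [hM ξ hξ]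
    exact (c1.eventually (hO.mem_nhds (hCO ξ hξ))).and
      (c3.norm.eventually (gt_mem_nhds hlt))
  have hint : ∀ᶠ ε : ℝ in 𝓝 0,
      MeasureTheory.IntegrableOn (pd (fun η => Φ (ε, w η)) α) K := by
    filter_upwards [hev] with ε hε
    have hc : ContinuousOn (pd (fun η => Φ (ε, w η)) α) C :=
      ContinuousOn.congr
        ((hΦ1.continuousOn.comp (hpair ε) fun ξ hξ => (hε ξ hξ).1).clm_apply hdir)
        fun ξ hξ => hpd ε ξ hξ (hε ξ hξ).1
    exact (hc.integrableOn_compact hC).mono_set hKC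
  have hDint : MeasureTheory.IntegrableOn (D 0) K := (hD0.integrableOn_compact hC).mono_set hKC
  refine ⟨hint, ?_, ?_⟩
  · exact hDint.congr_fun (fun ξ hξ => (hpd' ξ (hKC hξ)).symm) hK
  · rw [MeasureTheory.setIntegral_congr_fun hK fun ξ hξ => hpd' ξ (hKC hξ)]
    refine (hasDerivAt_integral_of_dominated_loc_of_deriv_le (F' := D) (bound := fun _ => M + 1)
      (hev.eventually_nhds) (hint.mono fun ε h => h.aestronglyMeasurable) hint.self_of_nhds
      hDint.aestronglyMeasurable ?_ ?_ ?_).2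
    · refine (MeasureTheory.ae_restrict_iff' hK).mpr
        (Filter.Eventually.of_forall fun ξ hξ ε hε => ?_)
      exact (hε.self_of_nhds ξ (hKC hξ)).2.le
    · exact (continuousOn_const.integrableOn_compact hC).mono_set hKC
    · refine (MeasureTheory.ae_restrict_iff' hK).mpr
        (Filter.Eventually.of_forall fun ξ hξ ε hε => ?_)
      have h1 : HasDerivAt (fun t : ℝ => (t, w ξ)) ((1 : ℝ), (0 : V)) ε :=
        (hasDerivAt_id ε).prodMk (hasDerivAt_const ε (w ξ))
      have h2 : HasDerivAt (fun t : ℝ => fderiv ℝ Φ (t, w ξ))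
          (fderiv ℝ (fderiv ℝ Φ) (ε, w ξ) (1, 0)) ε :=
        HasFDerivAt.comp_hasDerivAt (f := fun t : ℝ => (t, w ξ)) ε
          (hd1 _ (hε.self_of_nhds ξ (hKC hξ)).1) h1
      have h3 : HasDerivAt (fun t : ℝ => fderiv ℝ Φ (t, w ξ) (0, pd w α ξ)) (D ε ξ) ε :=
        (h2.clm_apply (hasDerivAt_const ε ((0 : ℝ), pd w α ξ))).congr_deriv
          (by simp only [map_zero, add_zero]; rfl)
      refine h3.congr_of_eventuallyEq ?_
      filter_upwards [hε] with t ht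
      exact hpd t ξ (hKC hξ) (ht ξ (hKC hξ)).1

/-! ### Rules for coordinate derivatives -/

theorem pd_smul {a : P2 → ℝ} {f : P2 → F} {ξ : P2} (ha : DifferentiableAt ℝ a ξ)
    (hf : DifferentiableAt ℝ f ξ) (α : Fin 2) :
    pd (fun η => a η • f η) α ξ = a ξ • pd f α ξ + pd a α ξ • f ξ := by
  simp [pd, fderiv_fun_smul ha hf]

theorem pd_sum {ι : Type*} [Fintype ι] {f : ι → P2 → F} {ξ : P2}
    (hf : ∀ i, DifferentiableAt ℝ (f i) ξ) (α : Fin 2) :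
    pd (fun η => ∑ i, f i η) α ξ = ∑ i, pd (f i) α ξ := by
  simp [pd, fderiv_fun_sum fun i _ => hf i]

theorem pd_apply {ι : Type*} [Fintype ι] {f : P2 → ι → F} {ξ : P2}
    (hf : DifferentiableAt ℝ f ξ) (α : Fin 2) (i : ι) :
    pd f α ξ i = pd (fun η => f η i) α ξ := by
  simp [pd, fderiv_apply hf]

theorem differentiableAt_coord {g : P2 → E3} {ξ : P2} (hg : DifferentiableAt ℝ g ξ) (i : Fin 3) :
    DifferentiableAt ℝ (fun η => g η i) ξ :=
  differentiableAt_euclidean.mp hg i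

theorem pd_coord {g : P2 → E3} {ξ : P2} (hg : DifferentiableAt ℝ g ξ) (α : Fin 2) (i : Fin 3) :
    pd (fun η => g η i) α ξ = pd g α ξ i := by
  have h : HasFDerivAt (fun η => g η i)
      ((EuclideanSpace.proj i : E3 →L[ℝ] ℝ).comp (fderiv ℝ g ξ)) ξ :=
    (EuclideanSpace.proj i : E3 →L[ℝ] ℝ).hasFDerivAt.comp ξ hg.hasFDerivAt
  rw [pd, h.fderiv]; rfl

theorem pd_congr {f g : P2 → F} {ξ : P2} (h : f =ᶠ[𝓝 ξ] g) (α : Fin 2) :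
    pd f α ξ = pd g α ξ := by
  rw [pd, pd, h.fderiv_eq]

/-! ### The divergence form of `D_S` -/

/-- The vectors `q × ν` and `ν × p`, where `ν` is the unit vector along `p × q`.  For
`p = ∂X/∂ξ₀`, `q = ∂X/∂ξ₁` these are `J_S ∇_S ξ₀` and `J_S ∇_S ξ₁`. -/
def conormal (p q : E3) : Fin 2 → E3 := ![cross q (nu p q), cross (nu p q) p]

/-- The field `J_S ∇_S ξ_α` of a parametrised surface. -/
def scaledGrad (X : P2 → E3) (α : Fin 2) (ξ : P2) : E3 := conormal (pd X 0 ξ) (pd X 1 ξ) α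

theorem coordGrad_eq (X : P2 → E3) (ξ : P2) (α : Fin 2) :
    coordGrad X ξ α = (jac X ξ)⁻¹ • scaledGrad X α ξ := by
  fin_cases α <;> rfl

theorem jac_smul_coordGrad {X : P2 → E3} {ξ : P2} (hX : areaVec X ξ ≠ 0) (α : Fin 2) :
    jac X ξ • coordGrad X ξ α = scaledGrad X α ξ := by
  have hJ : jac X ξ ≠ 0 := norm_ne_zero_iff.mpr hX
  rw [coordGrad_eq, smul_smul, mul_inv_cancel₀ hJ, one_smul]

theorem inner_unitNormal_self {X : P2 → E3} {ξ : P2} (hX : areaVec X ξ ≠ 0) :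
    inner ℝ (unitNormal X ξ) (unitNormal X ξ) = (1 : ℝ) :=
  inner_nu_self hX

theorem inner_scaledGrad_unitNormal (X : P2 → E3) (ξ : P2) (α : Fin 2) :
    inner ℝ (scaledGrad X α ξ) (unitNormal X ξ) = (0 : ℝ) := by
  rw [real_inner_comm]
  fin_cases α
  · exact inner_cross_right_self _ _
  · exact inner_cross_left_self _ _

theorem inner_coordGrad_unitNormal (X : P2 → E3) (ξ : P2) (α : Fin 2) :
    inner ℝ (coordGrad X ξ α) (unitNormal X ξ) = (0 : ℝ) := by
  rw [coordGrad_eq, real_inner_smul_left, inner_scaledGrad_unitNormal, mul_zero]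

theorem sum_mul_idS (X : P2 → E3) (ξ : P2) (v : E3) (j : Fin 3) :
    ∑ i, v i * idS X ξ i j = v j - inner ℝ v (unitNormal X ξ) * unitNormal X ξ j := by
  rw [inner_E3]
  fin_cases j <;>
    simp [idS, Matrix.vecMulVec_apply, Fin.sum_univ_three] <;> ring

/-- Tangential vectors are expanded in the basis `∇_S ξ_α`. -/
theorem eq_sum_inner_smul_coordGrad {X : P2 → E3} {ξ : P2} (hX : areaVec X ξ ≠ 0) {v : E3}
    (hv : inner ℝ v (unitNormal X ξ) = (0 : ℝ)) :
    v = ∑ α, (inner ℝ v (pd X α ξ) : ℝ) • coordGrad X ξ α := by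
  have hs : ∀ i j, idS X ξ i j = idS X ξ j i := fun i j => by
    simp [idS, Matrix.vecMulVec_apply, Matrix.one_apply, mul_comm, eq_comm]
  ext j
  have h1 := sum_mul_idS X ξ v j
  rw [hv, zero_mul, sub_zero] at h1
  have h2 : ∀ i, idS X ξ j i = ∑ α, coordGrad X ξ α j * pd X α ξ i := fun i => by
    simpa using (congrArg (fun u : E3 => u i) (sum_coordGrad_smul_pd X ξ hX j)).symm
  rw [← h1]
  simp only [hs _ j, h2, Fin.sum_univ_three, Fin.sum_univ_two, inner_E3, PiLp.add_apply,
    PiLp.smul_apply, smul_eq_mul]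
  ring

theorem contDiffAt_unitNormal {X : P2 → E3} {ξ : P2} {m r : WithTop ℕ∞} (hX : ContDiffAt ℝ r X ξ)
    (h : m + 1 ≤ r) (h0 : areaVec X ξ ≠ 0) : ContDiffAt ℝ m (unitNormal X) ξ :=
  contDiffAt_nu (hX.pd h 0) (hX.pd h 1) h0

theorem contDiffAt_conormal {V : Type*} [NormedAddCommGroup V] [NormedSpace ℝ V]
    {u v : V → E3} {x : V} {r : WithTop ℕ∞} (hu : ContDiffAt ℝ r u x) (hv : ContDiffAt ℝ r v x)
    (h : cross (u x) (v x) ≠ 0) (α : Fin 2) :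
    ContDiffAt ℝ r (fun y => conormal (u y) (v y) α) x := by
  fin_cases α
  · exact hv.cross (contDiffAt_nu hu hv h)
  · exact (contDiffAt_nu hu hv h).cross hu

theorem contDiffAt_scaledGrad {X : P2 → E3} {ξ : P2} {m r : WithTop ℕ∞} (hX : ContDiffAt ℝ r X ξ)
    (h : m + 1 ≤ r) (h0 : areaVec X ξ ≠ 0) (α : Fin 2) : ContDiffAt ℝ m (scaledGrad X α) ξ :=
  contDiffAt_conormal (hX.pd h 0) (hX.pd h 1) h0 α

theorem contDiffAt_coordGrad {X : P2 → E3} {ξ : P2} {m r : WithTop ℕ∞} (hX : ContDiffAt ℝ r X ξ)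
    (h : m + 1 ≤ r) (h0 : areaVec X ξ ≠ 0) (α : Fin 2) :
    ContDiffAt ℝ m (fun η => coordGrad X η α) ξ := by
  simp only [coordGrad_eq]
  exact ((((hX.pd h 0).cross (hX.pd h 1)).norm ℝ h0).inv (norm_ne_zero_iff.mpr h0)).smul
    (contDiffAt_scaledGrad hX h h0 α)

theorem eventually_areaVec_ne_zero {X : P2 → E3} {ξ : P2} (hX : ContDiffAt ℝ 1 X ξ)
    (h0 : areaVec X ξ ≠ 0) : ∀ᶠ η in 𝓝 ξ, areaVec X η ≠ 0 :=
  ((hX.pd (m := 0) (by norm_num) 0).cross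
    (hX.pd (m := 0) (by norm_num) 1)).continuousAt.eventually_ne h0

/-- The derivatives of a unit normal are tangential. -/
theorem inner_pd_unitNormal {X : P2 → E3} {ξ : P2} (hX : ContDiffAt ℝ 2 X ξ)
    (h0 : areaVec X ξ ≠ 0) (α : Fin 2) :
    inner ℝ (pd (unitNormal X) α ξ) (unitNormal X ξ) = (0 : ℝ) := by
  have hn : DifferentiableAt ℝ (unitNormal X) ξ :=
    (contDiffAt_unitNormal (m := 1) hX (by norm_num) h0).differentiableAt (by norm_num)
  have h1 : (fun η => inner ℝ (unitNormal X η) (unitNormal X η)) =ᶠ[𝓝 ξ] fun _ => (1 : ℝ) := by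
    filter_upwards [eventually_areaVec_ne_zero (hX.of_le (by norm_num)) h0] with η hη
    exact inner_nu_self hη
  have h2 := fderiv_inner_apply ℝ hn hn (EuclideanSpace.single α 1)
  rw [h1.fderiv_eq] at h2
  simp only [fderiv_fun_const, Pi.zero_apply, zero_apply] at h2
  rw [real_inner_comm (unitNormal X ξ)] at h2
  rw [pd, real_inner_comm]
  linarith

/-- `∑_α ∂_α (J_S ∇_S ξ_α)` is normal to the surface: the mixed second derivatives of `X` cancel,
and what is left are vector products of tangential vectors. -/
theorem sum_pd_scaledGrad_mul_idS {X : P2 → E3} {ξ : P2} (hX : ContDiffAt ℝ 2 X ξ)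
    (h0 : areaVec X ξ ≠ 0) (j : Fin 3) :
    ∑ α, ∑ i, pd (scaledGrad X α) α ξ i * idS X ξ i j = 0 := by
  have hd : ∀ α, DifferentiableAt ℝ (pd X α) ξ := fun α =>
    (hX.pd (m := 1) (by norm_num) α).differentiableAt (by norm_num)
  have hn : DifferentiableAt ℝ (unitNormal X) ξ :=
    (contDiffAt_unitNormal (m := 1) hX (by norm_num) h0).differentiableAt (by norm_num)
  have e : ∑ α, pd (scaledGrad X α) α ξ
      = cross (pd X 1 ξ) (pd (unitNormal X) 0 ξ) + cross (pd (unitNormal X) 1 ξ) (pd X 0 ξ) := by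
    have e0 : pd (scaledGrad X 0) 0 ξ = _ := pd_cross (hd 1) hn 0
    have e1 : pd (scaledGrad X 1) 1 ξ = _ := pd_cross hn (hd 0) 1
    rw [Fin.sum_univ_two, e0, e1, pd_pd_comm hX 1 0, cross_anticomm (unitNormal X ξ)]
    module
  have hself := inner_unitNormal_self h0
  have t0 := cross_sub_normal_part hself (pd X 1 ξ) (pd (unitNormal X) 0 ξ)
  have t1 := cross_sub_normal_part hself (pd (unitNormal X) 1 ξ) (pd X 0 ξ)
  rw [inner_pd_unitNormal hX h0, show inner ℝ (pd X 1 ξ) (unitNormal X ξ) = (0 : ℝ) from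
    inner_right_nu _ _, zero_smul, zero_smul, sub_zero] at t0
  rw [inner_pd_unitNormal hX h0, show inner ℝ (pd X 0 ξ) (unitNormal X ξ) = (0 : ℝ) from
    inner_left_nu _ _, zero_smul, zero_smul, sub_zero] at t1
  have e' := congrArg (fun v : E3 => ∑ i, v i * idS X ξ i j) e
  simp only [sum_mul_idS] at e'
  have t0' := congrArg (fun v : E3 => v j) t0
  have t1' := congrArg (fun v : E3 => v j) t1
  simp only [PiLp.sub_apply, PiLp.smul_apply, PiLp.zero_apply, smul_eq_mul] at t0' t1'
  simp only [sum_mul_idS]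
  rw [Finset.sum_sub_distrib, ← Finset.sum_mul, ← sum_inner]
  have e2 := congrArg (fun v : E3 => v j) e
  simp only [Fin.sum_univ_two, PiLp.add_apply] at e e2 ⊢
  rw [e, e2, inner_add_left, real_inner_comm (unitNormal X ξ), real_inner_comm (unitNormal X ξ)]
  linear_combination t0' + t1'

/-- The divergence form of `D_S`: `J_S D_S f = ∑_α ∂_α (J_S (∇_S ξ_α) f)`. -/
theorem jac_smul_DS {X : P2 → E3} {ξ : P2} (hX : ContDiffAt ℝ 2 X ξ) (h0 : areaVec X ξ ≠ 0)
    {f : P2 → F} (hf : DifferentiableAt ℝ f ξ) :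
    jac X ξ • DS X f ξ = ∑ α, pd (fun η j => scaledGrad X α η j • f η) α ξ := by
  have hB : ∀ α, DifferentiableAt ℝ (scaledGrad X α) ξ := fun α =>
    (contDiffAt_scaledGrad (m := 1) hX (by norm_num) h0 α).differentiableAt (by norm_num)
  have hB' := fun α j => differentiableAt_coord (hB α) j
  have hn : DifferentiableAt ℝ (unitNormal X) ξ :=
    (contDiffAt_unitNormal (m := 1) hX (by norm_num) h0).differentiableAt (by norm_num)
  have hI : ∀ i j, DifferentiableAt ℝ (fun η => idS X η i j) ξ := fun i j =>
    (differentiableAt_const _).sub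
      ((differentiableAt_coord hn i).mul (differentiableAt_coord hn j))
  have hT : ∀ α η j, ∑ i, scaledGrad X α η i * idS X η i j = scaledGrad X α η j := fun α η j => by
    rw [sum_mul_idS, inner_scaledGrad_unitNormal, zero_mul, sub_zero]
  funext j
  -- differentiate `hT` and drop the term that `sum_pd_scaledGrad_mul_idS` annihilates
  have hD : ∑ α, ∑ i, scaledGrad X α ξ i * pd (fun η => idS X η i j) α ξ
      = ∑ α, pd (scaledGrad X α) α ξ j := by
    have h1 : ∀ α, pd (scaledGrad X α) α ξ j
        = ∑ i, scaledGrad X α ξ i * pd (fun η => idS X η i j) α ξ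
          + ∑ i, pd (scaledGrad X α) α ξ i * idS X ξ i j := fun α => by
      rw [← pd_coord (hB α), ← Finset.sum_add_distrib]
      simp only [← hT α _ j]
      rw [pd_sum fun i => (hB' α i).fun_mul (hI i j)]
      refine Finset.sum_congr rfl fun i _ => ?_
      rw [← pd_coord (hB α)]
      exact pd_smul (hB' α i) (hI i j) α
    simp only [h1, Finset.sum_add_distrib]
    rw [sum_pd_scaledGrad_mul_idS hX h0 j, add_zero]
  have hR : ∀ α, pd (fun η j => scaledGrad X α η j • f η) α ξ j
      = scaledGrad X α ξ j • pd f α ξ + pd (scaledGrad X α) α ξ j • f ξ := fun α => by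
    rw [pd_apply (differentiableAt_pi.mpr fun j => (hB' α j).fun_smul hf), ← pd_coord (hB α)]
    exact pd_smul (hB' α j) hf α
  have hL : (jac X ξ • DS X f ξ) j
      = ∑ α, ∑ i, scaledGrad X α ξ i •
          (idS X ξ i j • pd f α ξ + pd (fun η => idS X η i j) α ξ • f ξ) := by
    simp only [DS, sderiv, Pi.smul_apply, Finset.smul_sum]
    rw [Finset.sum_comm]
    refine Finset.sum_congr rfl fun α _ => Finset.sum_congr rfl fun i _ => ?_
    rw [pd_smul (hI i j) hf, ← jac_smul_coordGrad h0, smul_smul]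
    rfl
  rw [hL, Finset.sum_apply]
  simp only [hR, smul_add, smul_smul, Finset.sum_add_distrib, ← Finset.sum_smul, hT, hD]

/-- The divergence form of the contraction `D_S · Ψ`. -/
theorem jac_smul_DSdot {X : P2 → E3} {ξ : P2} (hX : ContDiffAt ℝ 2 X ξ) (h0 : areaVec X ξ ≠ 0)
    {Ψ : P2 → Fin 3 → F} (hΨ : DifferentiableAt ℝ Ψ ξ) :
    jac X ξ • DSdot X Ψ ξ = ∑ α, pd (fun η => ∑ k, scaledGrad X α η k • Ψ η k) α ξ := by
  have hB : ∀ α k, DifferentiableAt ℝ (fun η => scaledGrad X α η k) ξ := fun α k =>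
    differentiableAt_coord
      ((contDiffAt_scaledGrad (m := 1) hX (by norm_num) h0 α).differentiableAt (by norm_num)) k
  have hk : ∀ k, jac X ξ • DS X Ψ ξ k k = ∑ α, pd (fun η => scaledGrad X α η k • Ψ η k) α ξ := by
    intro k
    have h := congrFun (congrFun (jac_smul_DS hX h0 hΨ) k) k
    simp only [Pi.smul_apply, Finset.sum_apply] at h
    rw [h]
    refine Finset.sum_congr rfl fun α _ => ?_
    rw [pd_apply (differentiableAt_pi.mpr fun j => (hB α j).fun_smul hΨ),
      pd_apply (f := fun η => scaledGrad X α η k • Ψ η) ((hB α k).fun_smul hΨ)]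
    rfl
  rw [DSdot, Finset.smul_sum, Finset.sum_congr rfl fun k _ => hk k, Finset.sum_comm]
  exact Finset.sum_congr rfl fun α _ =>
    (pd_sum (fun k => (hB α k).smul (differentiableAt_pi.mp hΨ k)) α).symm

/-! ### Variation of the normal and of the conormals -/

theorem gradSVec_apply (X r : P2 → E3) (ξ : P2) (i j : Fin 3) :
    gradSVec X r ξ i j = ∑ α, coordGrad X ξ α i * pd r α ξ j := by
  simp [gradSVec, gradS, sderiv]

theorem gradSVec_mulVec (X r : P2 → E3) (ξ : P2) :
    WithLp.toLp 2 (gradSVec X r ξ *ᵥ (unitNormal X ξ).ofLp)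
      = ∑ α, (inner ℝ (pd r α ξ) (unitNormal X ξ) : ℝ) • coordGrad X ξ α := by
  ext i
  simp only [Matrix.mulVec, dotProduct, gradSVec_apply, inner_E3, Fin.sum_univ_three,
    Fin.sum_univ_two, PiLp.add_apply, PiLp.smul_apply, smul_eq_mul]
  ring

/-- The variation of the unit normal is `-(∇_S r) · n`. -/
theorem hasDerivAt_nu_pd {X : P2 → E3} {ξ : P2} (hX : areaVec X ξ ≠ 0) (r : P2 → E3) :
    HasDerivAt (fun ε : ℝ => nu (pd X 0 ξ + ε • pd r 0 ξ) (pd X 1 ξ + ε • pd r 1 ξ))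
      (-WithLp.toLp 2 (gradSVec X r ξ *ᵥ (unitNormal X ξ).ofLp)) 0 := by
  refine (hasDerivAt_nu hX (pd r 0 ξ) (pd r 1 ξ)).congr_deriv ?_
  rw [gradSVec_mulVec, Fin.sum_univ_two, smul_add, smul_comm, smul_comm ‖_‖⁻¹]
  rfl

theorem vecMul_varTensor (X r : P2 → E3) (ξ : P2) (v : E3) :
    WithLp.toLp 2 (v.ofLp ᵥ* varTensor X r ξ)
      = ∑ α, ((inner ℝ (coordGrad X ξ α) (pd r α ξ) : ℝ) • v
          - (inner ℝ v (pd r α ξ) : ℝ) • coordGrad X ξ α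
          + ((inner ℝ v (coordGrad X ξ α) : ℝ) * inner ℝ (pd r α ξ) (unitNormal X ξ)) •
            unitNormal X ξ) := by
  have hm : gradSVec X r ξ *ᵥ (unitNormal X ξ).ofLp
      = (∑ α, (inner ℝ (pd r α ξ) (unitNormal X ξ) : ℝ) • coordGrad X ξ α).ofLp := by
    rw [← gradSVec_mulVec]
  ext j
  fin_cases j <;>
    simp [varTensor, hm, divS, Matrix.trace, Matrix.vecMul, dotProduct, gradSVec_apply,
      Matrix.vecMulVec_apply, inner_E3, Fin.sum_univ_three, Fin.sum_univ_two] <;> ring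

theorem inner_pd_coordGrad {X : P2 → E3} {ξ : P2} (hX : areaVec X ξ ≠ 0) (α β : Fin 2) :
    inner ℝ (pd X α ξ) (coordGrad X ξ β) = if α = β then (1 : ℝ) else 0 := by
  have hJ : jac X ξ ≠ 0 := norm_ne_zero_iff.mpr hX
  have hself : inner ℝ (unitNormal X ξ) (cross (pd X 0 ξ) (pd X 1 ξ)) = jac X ξ := by
    rw [← norm_smul_nu hX, real_inner_smul_right]
    change _ * inner ℝ (nu _ _) (nu _ _) = _
    rw [inner_nu_self hX, mul_one]; rfl
  have e0 : inner ℝ (pd X 0 ξ) (cross (pd X 1 ξ) (unitNormal X ξ)) = jac X ξ := by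
    rw [← hself]; simp only [inner_E3, cross_zero, cross_one, cross_two]; ring
  have e1 : inner ℝ (pd X 1 ξ) (cross (unitNormal X ξ) (pd X 0 ξ)) = jac X ξ := by
    rw [← hself]; simp only [inner_E3, cross_zero, cross_one, cross_two]; ring
  fin_cases α <;> fin_cases β <;>
    simp [coordGrad, real_inner_smul_right, hJ, e0, e1, inner_cross_left_self,
      inner_cross_right_self]

/-- The variation of `τ × n` for a tangent vector `τ` that moves with the surface. -/
theorem hasDerivAt_cross_nu {X : P2 → E3} {ξ : P2} (hX : areaVec X ξ ≠ 0) (r : P2 → E3)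
    (c : Fin 2 → ℝ) :
    HasDerivAt (fun ε : ℝ => cross (∑ α, c α • (pd X α ξ + ε • pd r α ξ))
        (nu (pd X 0 ξ + ε • pd r 0 ξ) (pd X 1 ξ + ε • pd r 1 ξ)))
      (WithLp.toLp 2 ((cross (∑ α, c α • pd X α ξ) (unitNormal X ξ)).ofLp ᵥ* varTensor X r ξ))
      0 := by
  set τ := ∑ α, c α • pd X α ξ with hτ
  have hl : HasDerivAt (fun ε : ℝ => ∑ α, c α • (pd X α ξ + ε • pd r α ξ))
      (∑ α, c α • pd r α ξ) 0 :=
    HasDerivAt.fun_sum fun α _ => ((((hasDerivAt_id (0 : ℝ)).smul_const (pd r α ξ)).const_add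
      (pd X α ξ)).const_smul (c α)).congr_deriv (by rw [one_smul])
  refine (hl.cross (hasDerivAt_nu_pd hX r)).congr_deriv ?_
  simp only [zero_smul, add_zero, ← hτ]
  change cross τ _ + cross _ (unitNormal X ξ) = _
  have hτn : inner ℝ τ (unitNormal X ξ) = (0 : ℝ) := by
    rw [hτ, sum_inner, Fin.sum_univ_two, real_inner_smul_left, real_inner_smul_left,
      show inner ℝ (pd X 0 ξ) (unitNormal X ξ) = (0 : ℝ) from inner_left_nu _ _,
      show inner ℝ (pd X 1 ξ) (unitNormal X ξ) = (0 : ℝ) from inner_right_nu _ _]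
    ring
  have hc : ∀ α, inner ℝ τ (coordGrad X ξ α) = c α := fun α => by
    simp only [hτ, sum_inner, real_inner_smul_left, inner_pd_coordGrad hX]
    simp
  rw [vecMul_varTensor]
  rw [← Finset.sum_congr rfl fun α _ => dyad_variation (inner_unitNormal_self hX) hτn
    (inner_coordGrad_unitNormal X ξ α) (pd r α ξ)]
  simp only [hc, gradSVec_mulVec, Finset.sum_sub_distrib]
  simp only [← crossL_apply, map_neg, map_sum, map_smul, sum_apply,
    smul_apply]
  exact neg_add_eq_sub _ _

/-- The variation of `J_S ∇_S ξ_α`, which up to sign is `τ × n` for a coordinate vector `τ`. -/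
theorem hasDerivAt_conormal {X : P2 → E3} {ξ : P2} (hX : areaVec X ξ ≠ 0) (r : P2 → E3)
    (α : Fin 2) :
    HasDerivAt (fun ε : ℝ => conormal (pd X 0 ξ + ε • pd r 0 ξ) (pd X 1 ξ + ε • pd r 1 ξ) α)
      (WithLp.toLp 2 ((scaledGrad X α ξ).ofLp ᵥ* varTensor X r ξ)) 0 := by
  fin_cases α
  · have h := hasDerivAt_cross_nu hX r ![0, 1]
    simp only [Fin.sum_univ_two, Matrix.cons_val_zero, Matrix.cons_val_one, one_smul, zero_smul,
      zero_add] at h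
    exact h
  · have h := (hasDerivAt_cross_nu hX r ![1, 0]).neg
    simp only [Fin.sum_univ_two, Matrix.cons_val_zero, Matrix.cons_val_one, one_smul, zero_smul,
      add_zero] at h
    refine (h.congr_deriv ?_).congr_of_eventuallyEq (Filter.Eventually.of_forall fun ε => ?_)
    · rw [← WithLp.toLp_neg, ← Matrix.neg_vecMul, ← WithLp.ofLp_neg, ← cross_anticomm]
      rfl
    · exact cross_anticomm _ _

theorem pd_displace {X : P2 → E3} {ρ : E3 → E3} {ξ : P2} (hX : DifferentiableAt ℝ X ξ)
    (hρ : DifferentiableAt ℝ (ρ ∘ X) ξ) (ε : ℝ) (α : Fin 2) :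
    pd (displace X ρ ε) α ξ = pd X α ξ + ε • pd (ρ ∘ X) α ξ := by
  have h := (hX.hasFDerivAt.add (hρ.hasFDerivAt.const_smul ε)).fderiv
  change fderiv ℝ (X + ε • (ρ ∘ X)) ξ _ = _
  rw [h]; rfl

/-- `n_S dΓ = γ' × n`; this also holds where `γ' = 0`, both sides being zero. -/
theorem normalLineElement_eq (X : P2 → E3) (c : ℝ → P2) (s : ℝ) :
    normalLineElement X c s = cross (deriv (X ∘ c) s) (unitNormal X (c s)) := by
  rw [normalLineElement, cross_smul_left]
  rcases eq_or_ne (deriv (X ∘ c) s) 0 with h | h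
  · rw [h, ← zero_smul ℝ (0 : E3), cross_smul_left]; simp
  · rw [smul_smul, mul_inv_cancel₀ (norm_ne_zero_iff.mpr h), one_smul]

theorem deriv_comp_eq_sum {X : P2 → E3} {c : ℝ → P2} {s : ℝ} (hX : DifferentiableAt ℝ X (c s))
    (hc : DifferentiableAt ℝ c s) :
    deriv (X ∘ c) s = ∑ α, deriv c s α • pd X α (c s) := by
  rw [fderiv_comp_deriv s hX hc]
  have h : deriv c s = ∑ α, deriv c s α • EuclideanSpace.single α (1 : ℝ) := by
    ext j; fin_cases j <;> simp [Fin.sum_univ_two]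
  conv_lhs => rw [h]
  simp [pd]

theorem areaVec_ne_zero {X : P2 → E3} {ξ : P2}
    (h : LinearIndependent ℝ ![pd X 0 ξ, pd X 1 ξ]) : areaVec X ξ ≠ 0 := by
  have h1 : LinearIndependent ℝ ![(pd X 0 ξ).ofLp, (pd X 1 ξ).ofLp] := by
    rw [LinearIndependent.pair_iff] at h ⊢
    intro s t hst
    exact h s t (by ext j; simpa using congrFun hst j)
  intro h0
  exact crossProduct_ne_zero_iff_linearIndependent.mpr h1 (congrArg WithLp.ofLp h0)

/-! ### Variation of the integral over one piece -/

/-- The surface data that enter `J_S D_S φ` on the displaced surfaces: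
`(X, r)`, `(∂X/∂ξ₀, ∂r/∂ξ₀)`, `(∂X/∂ξ₁, ∂r/∂ξ₁)`. -/
def jet (X r : P2 → E3) (ξ : P2) : (E3 × E3) × (E3 × E3) × (E3 × E3) :=
  ((X ξ, r ξ), (pd X 0 ξ, pd r 0 ξ), (pd X 1 ξ, pd r 1 ξ))

/-- `J_S (∇_S ξ_α) φ` on the surface displaced by `ε r`, as a function of `ε` and the jet. -/
def flux (φ : E3 → F) (α : Fin 2) (z : ℝ × (E3 × E3) × (E3 × E3) × (E3 × E3)) : Fin 3 → F :=
  fun j => conormal (z.2.2.1.1 + z.1 • z.2.2.1.2) (z.2.2.2.1 + z.1 • z.2.2.2.2) α j •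
    φ (z.2.1.1 + z.1 • z.2.1.2)

/-- The pairs of `ε` and a jet for which the displaced surface is immersed and lies in `W`. -/
def fluxDomain (W : Set E3) : Set (ℝ × (E3 × E3) × (E3 × E3) × (E3 × E3)) :=
  {z | cross (z.2.2.1.1 + z.1 • z.2.2.1.2) (z.2.2.2.1 + z.1 • z.2.2.2.2) ≠ 0 ∧
    z.2.1.1 + z.1 • z.2.1.2 ∈ W}

theorem isOpen_fluxDomain {W : Set E3} (hW : IsOpen W) : IsOpen (fluxDomain W) := by
  have hc : Continuous fun z : ℝ × (E3 × E3) × (E3 × E3) × (E3 × E3) =>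
      cross (z.2.2.1.1 + z.1 • z.2.2.1.2) (z.2.2.2.1 + z.1 • z.2.2.2.2) := by
    refine continuous_iff_continuousAt.mpr fun z => ContDiffAt.continuousAt (𝕜 := ℝ) (n := 0) ?_
    exact ContDiffAt.cross (by fun_prop) (by fun_prop)
  exact (isOpen_ne.preimage hc).inter (hW.preimage (by fun_prop))

theorem contDiffOn_flux {W : Set E3} (hW : IsOpen W) {φ : E3 → F} {r : WithTop ℕ∞}
    (hφ : ContDiffOn ℝ r φ W) (α : Fin 2) : ContDiffOn ℝ r (flux φ α) (fluxDomain W) := by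
  intro z hz
  refine ContDiffAt.contDiffWithinAt (contDiffAt_pi.mpr fun j => ?_)
  refine ContDiffAt.smul ?_ ?_
  · exact contDiffAt_euclidean.mp
      (contDiffAt_conormal (by fun_prop) (by fun_prop) hz.1 α) j
  · exact ContDiffAt.comp (g := φ) z (hφ.contDiffAt (hW.mem_nhds hz.2)) (by fun_prop)

theorem flux_jet {X : P2 → E3} {ρ : E3 → E3} {ξ : P2} (hX : DifferentiableAt ℝ X ξ)
    (hρ : DifferentiableAt ℝ (ρ ∘ X) ξ) (φ : E3 → F) (α : Fin 2) (ε : ℝ) :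
    flux φ α (ε, jet X (ρ ∘ X) ξ)
      = fun j => scaledGrad (displace X ρ ε) α ξ j • (φ ∘ displace X ρ ε) ξ := by
  funext j
  rw [scaledGrad, pd_displace hX hρ, pd_displace hX hρ]
  rfl

theorem jet_mem_fluxDomain {X r : P2 → E3} {ξ : P2} {W : Set E3} (h0 : areaVec X ξ ≠ 0)
    (hξ : X ξ ∈ W) : ((0 : ℝ), jet X r ξ) ∈ fluxDomain W := by
  simp only [fluxDomain, jet, Set.mem_ofPred_eq, zero_smul, add_zero]
  exact ⟨h0, hξ⟩

/-- The first variation of `J_S (∇_S ξ_α) φ`: the variation `(J_S ∇_S ξ_α) · A` of the conormal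
and the directional derivative of `φ` along the displacement combine to the flux of
`[A + I (ρ · ∇)] φ`. -/
theorem fderiv_flux_jet {X : P2 → E3} {ρ : E3 → E3} {ξ : P2} {W : Set E3} (hW : IsOpen W)
    {φ : E3 → F} (hφ : ContDiffOn ℝ 2 φ W) (h0 : areaVec X ξ ≠ 0) (hξ : X ξ ∈ W) (α : Fin 2) :
    fderiv ℝ (flux φ α) (0, jet X (ρ ∘ X) ξ) (1, 0)
      = ∑ k, scaledGrad X α ξ k •
          firstOrderField X (varTensor X (ρ ∘ X)) ρ φ ξ k := by
  have hO : ((0 : ℝ), jet X (ρ ∘ X) ξ) ∈ fluxDomain W := jet_mem_fluxDomain h0 hξ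
  have hd : HasFDerivAt (flux φ α) _ (0, jet X (ρ ∘ X) ξ) :=
    (((contDiffOn_flux hW hφ α).contDiffAt
      ((isOpen_fluxDomain hW).mem_nhds hO)).differentiableAt (by norm_num)).hasFDerivAt
  have h1 : HasDerivAt (fun ε : ℝ => (ε, jet X (ρ ∘ X) ξ)) (1, 0) 0 :=
    (hasDerivAt_id 0).prodMk (hasDerivAt_const 0 _)
  have h2 : HasDerivAt (fun ε : ℝ => flux φ α (ε, jet X (ρ ∘ X) ξ))
      (fderiv ℝ (flux φ α) (0, jet X (ρ ∘ X) ξ) (1, 0)) 0 :=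
    HasFDerivAt.comp_hasDerivAt (f := fun ε : ℝ => (ε, jet X (ρ ∘ X) ξ)) 0 hd h1
  refine h2.unique (hasDerivAt_pi.mpr fun j => ?_)
  have hB := (EuclideanSpace.proj j : E3 →L[ℝ] ℝ).hasFDerivAt.comp_hasDerivAt 0
    (hasDerivAt_conormal h0 (ρ ∘ X) α)
  have hl : HasDerivAt (fun ε : ℝ => X ξ + ε • ρ (X ξ)) (ρ (X ξ)) 0 :=
    (((hasDerivAt_id (0 : ℝ)).smul_const (ρ (X ξ))).const_add (X ξ)).congr_deriv (one_smul _ _)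
  have hφd : HasFDerivAt φ (fderiv ℝ φ (X ξ)) (X ξ + (0 : ℝ) • ρ (X ξ)) := by
    rw [zero_smul, add_zero]
    exact ((hφ.contDiffAt (hW.mem_nhds hξ)).differentiableAt (by norm_num)).hasFDerivAt
  have hφ' : HasDerivAt (fun ε : ℝ => φ (X ξ + ε • ρ (X ξ))) (fderiv ℝ φ (X ξ) (ρ (X ξ))) 0 :=
    HasFDerivAt.comp_hasDerivAt (f := fun ε : ℝ => X ξ + ε • ρ (X ξ)) 0 hφd hl
  refine (hB.smul hφ').congr_deriv ?_
  simp only [Function.comp_apply, PiLp.proj_apply, zero_smul, add_zero, Finset.sum_apply,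
    Pi.smul_apply, firstOrderField, smul_add, Finset.sum_add_distrib, smul_smul,
    ← Finset.sum_smul, Matrix.one_apply, mul_ite, mul_one,
    mul_zero, Finset.sum_ite_eq', Finset.mem_univ, if_true]
  rw [add_comm]
  rfl

theorem contDiffAt_displace {X : P2 → E3} {ρ : E3 → E3} {ξ : P2} {m : WithTop ℕ∞}
    (hX : ContDiffAt ℝ m X ξ) (hρ : ContDiffAt ℝ m (ρ ∘ X) ξ) (ε : ℝ) :
    ContDiffAt ℝ m (displace X ρ ε) ξ :=
  hX.add (hρ.const_smul ε)

theorem differentiableAt_gradSVec {X r : P2 → E3} {ξ : P2} (hX : ContDiffAt ℝ 2 X ξ)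
    (h0 : areaVec X ξ ≠ 0) (hr : ContDiffAt ℝ 2 r ξ) (i j : Fin 3) :
    DifferentiableAt ℝ (fun η => gradSVec X r η i j) ξ := by
  simp only [gradSVec_apply]
  refine DifferentiableAt.fun_sum fun α _ => DifferentiableAt.fun_mul ?_ ?_
  · exact differentiableAt_coord ((contDiffAt_coordGrad (m := 1) hX (by norm_num) h0
      α).differentiableAt (by norm_num)) i
  · exact differentiableAt_coord ((hr.pd (m := 1) (by norm_num) α).differentiableAt
      (by norm_num)) j

theorem differentiableAt_divS {X r : P2 → E3} {ξ : P2} (hX : ContDiffAt ℝ 2 X ξ)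
    (h0 : areaVec X ξ ≠ 0) (hr : ContDiffAt ℝ 2 r ξ) : DifferentiableAt ℝ (divS X r) ξ := by
  change DifferentiableAt ℝ (fun η => ∑ i, gradSVec X r η i i) ξ
  exact DifferentiableAt.fun_sum fun i _ => differentiableAt_gradSVec hX h0 hr i i

theorem differentiableAt_unitNormal_coord {X : P2 → E3} {ξ : P2} (hX : ContDiffAt ℝ 2 X ξ)
    (h0 : areaVec X ξ ≠ 0) (i : Fin 3) : DifferentiableAt ℝ (fun η => unitNormal X η i) ξ :=
  differentiableAt_coord
    ((contDiffAt_unitNormal (m := 1) hX (by norm_num) h0).differentiableAt (by norm_num)) i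

theorem differentiableAt_varTensor {X r : P2 → E3} {ξ : P2} (hX : ContDiffAt ℝ 2 X ξ)
    (h0 : areaVec X ξ ≠ 0) (hr : ContDiffAt ℝ 2 r ξ) (i j : Fin 3) :
    DifferentiableAt ℝ (fun η => varTensor X r η i j) ξ := by
  have hn := differentiableAt_unitNormal_coord hX h0
  have hg := differentiableAt_gradSVec hX h0 hr
  exact (((differentiableAt_divS hX h0 hr).mul_const _).sub (hg j i)).add
    ((DifferentiableAt.fun_sum (u := Finset.univ) fun k _ => (hg i k).fun_mul (hn k)).mul (hn j))

theorem differentiableAt_varTensorNormal {X : P2 → E3} {h : P2 → ℝ} {ξ : P2}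
    (hX : ContDiffAt ℝ 3 X ξ) (h0 : areaVec X ξ ≠ 0) (hh : ContDiffAt ℝ 2 h ξ) (i j : Fin 3) :
    DifferentiableAt ℝ (fun η => varTensorNormal X h η i j) ξ := by
  have hX2 : ContDiffAt ℝ 2 X ξ := hX.of_le (by norm_num)
  have hn2 : ContDiffAt ℝ 2 (unitNormal X) ξ := contDiffAt_unitNormal hX (by norm_num) h0
  have hn := differentiableAt_unitNormal_coord hX2 h0
  have hg := differentiableAt_gradSVec hX2 h0 hn2
  have hh1 : DifferentiableAt ℝ h ξ := hh.differentiableAt (by norm_num)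
  have hgr : DifferentiableAt ℝ (fun η => gradS X h η i) ξ := by
    change DifferentiableAt ℝ (fun η => ∑ α, coordGrad X η α i • pd h α η) ξ
    refine DifferentiableAt.fun_sum fun α _ => DifferentiableAt.fun_smul ?_ ?_
    · exact differentiableAt_coord ((contDiffAt_coordGrad (m := 1) hX2 (by norm_num) h0
        α).differentiableAt (by norm_num)) i
    · exact (hh.pd (m := 1) (by norm_num) α).differentiableAt (by norm_num)
  exact (((hh1.mul (differentiableAt_divS hX2 h0 hn2)).mul_const _).sub (hh1.mul (hg i j))).add
    (hgr.mul (hn j))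

theorem differentiableAt_firstOrderField {X : P2 → E3} {A : P2 → Matrix (Fin 3) (Fin 3) ℝ}
    {ρ : E3 → E3} {φ : E3 → F} {ξ : P2} (hX : DifferentiableAt ℝ X ξ)
    (hA : ∀ i j, DifferentiableAt ℝ (fun η => A η i j) ξ) (hρ : DifferentiableAt ℝ (ρ ∘ X) ξ)
    (hφ : ContDiffAt ℝ 2 φ (X ξ)) : DifferentiableAt ℝ (firstOrderField X A ρ φ) ξ := by
  refine differentiableAt_pi.mpr fun k => differentiableAt_pi.mpr fun l => ?_
  have h1 : DifferentiableAt ℝ (φ ∘ X) ξ :=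
    (hφ.differentiableAt (by norm_num)).comp ξ hX
  have h2 : DifferentiableAt ℝ (fderiv ℝ φ ∘ X) ξ :=
    ((hφ.fderiv_right (m := 1) (by norm_num)).differentiableAt (by norm_num)).comp ξ hX
  exact ((hA k l).smul h1).add ((h2.clm_apply hρ).const_smul _)

/-- The variation of `∫ D_S φ dΣ` over one parametrised piece: in divergence form the integrand
is a sum of coordinate derivatives of `flux`. -/
theorem variation_piece {X : P2 → E3} {ρ : E3 → E3} {φ : E3 → F} {U C K : Set P2} {W : Set E3}
    (hU : IsOpen U) (hX : ContDiffOn ℝ 2 X U) (h0 : ∀ ξ ∈ U, areaVec X ξ ≠ 0)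
    (hρ : ContDiffOn ℝ 2 (ρ ∘ X) U) (hC : IsCompact C) (hCU : C ⊆ U) (hK : MeasurableSet K)
    (hKC : K ⊆ C) (hW : IsOpen W) (hφ : ContDiffOn ℝ 2 φ W) (hCW : ∀ ξ ∈ C, X ξ ∈ W) :
    (∀ᶠ ε : ℝ in 𝓝 0, MeasureTheory.IntegrableOn
      (fun ξ => jac (displace X ρ ε) ξ • DS (displace X ρ ε) (φ ∘ displace X ρ ε) ξ) K) ∧
    MeasureTheory.IntegrableOn (fun ξ => jac X ξ •
      DSdot X (firstOrderField X (varTensor X (ρ ∘ X)) ρ φ) ξ) K ∧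
    HasDerivAt (fun ε : ℝ => ∫ ξ in K,
        jac (displace X ρ ε) ξ • DS (displace X ρ ε) (φ ∘ displace X ρ ε) ξ)
      (∫ ξ in K, jac X ξ • DSdot X (firstOrderField X (varTensor X (ρ ∘ X)) ρ φ) ξ) 0 := by
  have hX' : ∀ ξ ∈ U, ContDiffAt ℝ 2 X ξ := fun ξ hξ => hX.contDiffAt (hU.mem_nhds hξ)
  have hρ' : ∀ ξ ∈ U, ContDiffAt ℝ 2 (ρ ∘ X) ξ := fun ξ hξ => hρ.contDiffAt (hU.mem_nhds hξ)
  have hXd : ∀ ξ ∈ U, DifferentiableAt ℝ X ξ := fun ξ hξ =>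
    (hX' ξ hξ).differentiableAt (by norm_num)
  have hρd : ∀ ξ ∈ U, DifferentiableAt ℝ (ρ ∘ X) ξ := fun ξ hξ =>
    (hρ' ξ hξ).differentiableAt (by norm_num)
  have hX1 := fun α => hX.pd hU (m := 1) (by norm_num) α
  have hρ1 := fun α => hρ.pd hU (m := 1) (by norm_num) α
  have hjet : ContDiffOn ℝ 1 (jet X (ρ ∘ X)) U :=
    ((hX.of_le (by norm_num)).prodMk (hρ.of_le (by norm_num))).prodMk
      (((hX1 0).prodMk (hρ1 0)).prodMk ((hX1 1).prodMk (hρ1 1)))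
  have hO := isOpen_fluxDomain hW
  have hCO : ∀ ξ ∈ C, ((0 : ℝ), jet X (ρ ∘ X) ξ) ∈ fluxDomain W := fun ξ hξ =>
    jet_mem_fluxDomain (h0 ξ (hCU hξ)) (hCW ξ hξ)
  have main := fun α => hasDerivAt_integral_pd hO (contDiffOn_flux hW hφ α) hU hjet hC hCU hCO hK
    hKC α
  -- by compactness of `C`, the displaced pieces are immersed and lie in `W` for small `ε`
  have hev : ∀ᶠ ε : ℝ in 𝓝 0, ∀ ξ ∈ C, (ε, jet X (ρ ∘ X) ξ) ∈ fluxDomain W := by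
    refine hC.eventually_forall_of_forall_eventually
      (P := fun ε ξ => (ε, jet X (ρ ∘ X) ξ) ∈ fluxDomain W) fun ξ hξ => ?_
    have c1 : ContinuousAt (fun z : ℝ × P2 => (z.1, jet X (ρ ∘ X) z.2)) (0, ξ) :=
      continuousAt_fst.prodMk (ContinuousAt.comp (f := Prod.snd)
        (hjet.continuousOn.continuousAt (hU.mem_nhds (hCU hξ))) continuousAt_snd)
    exact c1.eventually (hO.mem_nhds (hCO ξ hξ))
  have hL : ∀ᶠ ε : ℝ in 𝓝 0, ∀ ξ ∈ K,
      jac (displace X ρ ε) ξ • DS (displace X ρ ε) (φ ∘ displace X ρ ε) ξ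
        = ∑ α, pd (fun η => flux φ α (ε, jet X (ρ ∘ X) η)) α ξ := by
    filter_upwards [hev] with ε hε ξ hξK
    have hξC := hKC hξK
    have hξ := hCU hξC
    have ha : areaVec (displace X ρ ε) ξ ≠ 0 := by
      rw [areaVec, pd_displace (hXd ξ hξ) (hρd ξ hξ), pd_displace (hXd ξ hξ) (hρd ξ hξ)]
      exact (hε ξ hξC).1
    have hc := contDiffAt_displace (hX' ξ hξ) (hρ' ξ hξ) ε
    have hf : DifferentiableAt ℝ (φ ∘ displace X ρ ε) ξ :=
      DifferentiableAt.comp ξ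
        ((hφ.contDiffAt (hW.mem_nhds (hε ξ hξC).2)).differentiableAt (by norm_num))
        (hc.differentiableAt (by norm_num))
    rw [jac_smul_DS hc ha hf]
    refine Finset.sum_congr rfl fun α _ => pd_congr ?_ α
    filter_upwards [hU.mem_nhds hξ] with η hη
    exact (flux_jet (hXd η hη) (hρd η hη) φ α ε).symm
  have hR : ∀ ξ ∈ K, jac X ξ • DSdot X (firstOrderField X (varTensor X (ρ ∘ X)) ρ φ) ξ
      = ∑ α, pd (fun η => fderiv ℝ (flux φ α) (0, jet X (ρ ∘ X) η) (1, 0)) α ξ := by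
    intro ξ hξK
    have hξ := hCU (hKC hξK)
    have hWξ := hW.mem_nhds (hCW ξ (hKC hξK))
    have hd : DifferentiableAt ℝ (firstOrderField X (varTensor X (ρ ∘ X)) ρ φ) ξ :=
      differentiableAt_firstOrderField (hXd ξ hξ)
        (fun i j => differentiableAt_varTensor (hX' ξ hξ) (h0 ξ hξ) (hρ' ξ hξ) i j) (hρd ξ hξ)
        (hφ.contDiffAt hWξ)
    rw [jac_smul_DSdot (hX' ξ hξ) (h0 ξ hξ) hd]
    refine Finset.sum_congr rfl fun α _ => pd_congr ?_ α
    filter_upwards [hU.mem_nhds hξ, (hXd ξ hξ).continuousAt.preimage_mem_nhds hWξ] with η hη hηW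
    exact (fderiv_flux_jet hW hφ (h0 η hη) hηW α).symm
  have hI : ∀ᶠ ε : ℝ in 𝓝 0, ∀ α, MeasureTheory.IntegrableOn
      (pd (fun η => flux φ α (ε, jet X (ρ ∘ X) η)) α) K :=
    Filter.eventually_all.mpr fun α => (main α).1
  refine ⟨?_, ?_, ?_⟩
  · filter_upwards [hI, hL] with ε h1 h2
    exact MeasureTheory.IntegrableOn.congr_fun
      (MeasureTheory.integrable_finsetSum _ fun α _ => h1 α)
      (fun ξ hξ => (h2 ξ hξ).symm) hK
  · exact MeasureTheory.IntegrableOn.congr_fun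
      (MeasureTheory.integrable_finsetSum _ fun α _ => (main α).2.1)
      (fun ξ hξ => (hR ξ hξ).symm) hK
  · rw [MeasureTheory.setIntegral_congr_fun hK hR,
      MeasureTheory.integral_finsetSum _ fun α _ => (main α).2.1]
    refine (HasDerivAt.fun_sum fun α _ => (main α).2.2).congr_of_eventuallyEq ?_
    filter_upwards [hI, hL] with ε h1 h2
    rw [MeasureTheory.setIntegral_congr_fun hK h2,
      MeasureTheory.integral_finsetSum _ fun α _ => h1 α]

/-! ### Normal displacements -/

/-- `∇_S n` is symmetric: with `L_{αβ} = ∂_α n · ∂_β X = -n · ∂_α ∂_β X` it equals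
`∑ L_{αβ} (∇_S ξ_α) (∇_S ξ_β)`. -/
theorem gradSVec_unitNormal_symm {X : P2 → E3} {ξ : P2} (hX : ContDiffAt ℝ 2 X ξ)
    (h0 : areaVec X ξ ≠ 0) (i j : Fin 3) :
    gradSVec X (unitNormal X) ξ i j = gradSVec X (unitNormal X) ξ j i := by
  have hn : DifferentiableAt ℝ (unitNormal X) ξ :=
    (contDiffAt_unitNormal (m := 1) hX (by norm_num) h0).differentiableAt (by norm_num)
  have hL : ∀ α β, (inner ℝ (pd (unitNormal X) α ξ) (pd X β ξ) : ℝ)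
      = -inner ℝ (unitNormal X ξ) (pd (pd X β) α ξ) := fun α β => by
    have hd : DifferentiableAt ℝ (pd X β) ξ :=
      (hX.pd (m := 1) (by norm_num) β).differentiableAt (by norm_num)
    have h2 := fderiv_inner_apply ℝ hn hd (EuclideanSpace.single α 1)
    have h3 : (fun η => (inner ℝ (unitNormal X η) (pd X β η) : ℝ)) = fun _ => 0 := by
      funext η
      rw [real_inner_comm]
      fin_cases β
      · exact inner_left_nu _ _
      · exact inner_right_nu _ _
    rw [h3] at h2
    simp only [fderiv_fun_const, Pi.zero_apply, zero_apply] at h2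
    change _ = -inner ℝ (unitNormal X ξ) (fderiv ℝ (pd X β) ξ _)
    rw [pd]
    linarith
  have he : ∀ α, pd (unitNormal X) α ξ = ∑ β, (inner ℝ (pd (unitNormal X) α ξ) (pd X β ξ) : ℝ) •
      coordGrad X ξ β := fun α =>
    eq_sum_inner_smul_coordGrad h0 (inner_pd_unitNormal hX h0 α)
  rw [gradSVec_apply, gradSVec_apply]
  simp only [Fin.sum_univ_two] at he ⊢
  rw [he 0, he 1, hL 0 1, hL 1 0, pd_pd_comm hX 1 0]
  simp only [PiLp.add_apply, PiLp.smul_apply, smul_eq_mul]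
  ring

/-- For a displacement `h n` the two variation tensors differ by the dyad `n ∇_S h`. -/
theorem varTensor_normal {X r : P2 → E3} {h : P2 → ℝ} {ξ : P2} (hX : ContDiffAt ℝ 2 X ξ)
    (h0 : areaVec X ξ ≠ 0) (hh : DifferentiableAt ℝ h ξ)
    (hr : r =ᶠ[𝓝 ξ] fun η => h η • unitNormal X η) :
    varTensor X r ξ = varTensorNormal X h ξ
      - Matrix.vecMulVec (unitNormal X ξ).ofLp (gradS X h ξ) := by
  have hn : DifferentiableAt ℝ (unitNormal X) ξ :=
    (contDiffAt_unitNormal (m := 1) hX (by norm_num) h0).differentiableAt (by norm_num)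
  have hpd : ∀ α, pd r α ξ = h ξ • pd (unitNormal X) α ξ + pd h α ξ • unitNormal X ξ := fun α => by
    rw [pd_congr hr]; exact pd_smul hh hn α
  have hG : ∀ i j, gradSVec X r ξ i j
      = h ξ * gradSVec X (unitNormal X) ξ i j + gradS X h ξ i * unitNormal X ξ j := fun i j => by
    simp only [gradSVec_apply, gradS, sderiv, hpd, Fin.sum_univ_two, PiLp.add_apply,
      PiLp.smul_apply, smul_eq_mul]
    ring
  have hGn : ∀ i, (gradSVec X r ξ *ᵥ (unitNormal X ξ).ofLp) i = gradS X h ξ i := fun i => by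
    refine (congrArg (fun v : E3 => v i) (gradSVec_mulVec X r ξ)).trans ?_
    have h1 : ∀ α, (inner ℝ (pd r α ξ) (unitNormal X ξ) : ℝ) = pd h α ξ := fun α => by
      rw [hpd, inner_add_left, real_inner_smul_left, real_inner_smul_left,
        inner_pd_unitNormal hX h0, inner_unitNormal_self h0, mul_zero, zero_add, mul_one]
    simp [h1, gradS, sderiv, Fin.sum_univ_two, mul_comm]
  have ht : ∑ k, gradS X h ξ k * unitNormal X ξ k = 0 := by
    have e0 := inner_coordGrad_unitNormal X ξ 0
    have e1 := inner_coordGrad_unitNormal X ξ 1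
    rw [inner_E3] at e0 e1
    simp only [gradS, sderiv, Fin.sum_univ_two, Fin.sum_univ_three, smul_eq_mul]
    linear_combination pd h 0 ξ * e0 + pd h 1 ξ * e1
  have hdiv : divS X r ξ = h ξ * divS X (unitNormal X) ξ := by
    simp only [divS, Matrix.trace, Matrix.diag, hG, Finset.sum_add_distrib, ht, add_zero,
      Finset.mul_sum]
  ext i j
  simp only [varTensor, varTensorNormal, hdiv, Matrix.add_apply, Matrix.sub_apply,
    Matrix.smul_apply, Matrix.transpose_apply, Matrix.vecMulVec_apply, hGn, hG, smul_eq_mul]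
  rw [gradSVec_unitNormal_symm hX h0 j i]
  ring

/-- `D_S ·` does not see the dyad `n ∇_S h`, because `J_S ∇_S ξ_α` is tangential. -/
theorem jac_smul_DSdot_normal {X : P2 → E3} {ρ : E3 → E3} {h : P2 → ℝ} {φ : E3 → F} {U : Set P2}
    {ξ : P2} (hU : IsOpen U) (hξ : ξ ∈ U) (hX : ContDiffOn ℝ 3 X U)
    (h0 : ∀ η ∈ U, areaVec X η ≠ 0) (hh : ContDiffOn ℝ 2 h U)
    (hρ : ∀ η ∈ U, ρ (X η) = h η • unitNormal X η) (hφ : ContDiffAt ℝ 2 φ (X ξ)) :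
    jac X ξ • DSdot X (firstOrderField X (varTensor X (ρ ∘ X)) ρ φ) ξ
      = jac X ξ • DSdot X (firstOrderField X (varTensorNormal X h) ρ φ) ξ := by
  have hX3 : ∀ η ∈ U, ContDiffAt ℝ 3 X η := fun η hη => hX.contDiffAt (hU.mem_nhds hη)
  have hX2 : ∀ η ∈ U, ContDiffAt ℝ 2 X η := fun η hη => (hX3 η hη).of_le (by norm_num)
  have hh2 : ∀ η ∈ U, ContDiffAt ℝ 2 h η := fun η hη => hh.contDiffAt (hU.mem_nhds hη)
  have hr : ∀ η ∈ U, ρ ∘ X =ᶠ[𝓝 η] fun ζ => h ζ • unitNormal X ζ := fun η hη => by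
    filter_upwards [hU.mem_nhds hη] with ζ hζ using hρ ζ hζ
  have hr2 : ContDiffAt ℝ 2 (ρ ∘ X) ξ :=
    ((hh2 ξ hξ).smul (contDiffAt_unitNormal (hX3 ξ hξ) (by norm_num)
      (h0 ξ hξ))).congr_of_eventuallyEq (hr ξ hξ)
  have hXd := (hX2 ξ hξ).differentiableAt (by norm_num)
  have hrd := hr2.differentiableAt (by norm_num)
  have hd1 : DifferentiableAt ℝ (firstOrderField X (varTensor X (ρ ∘ X)) ρ φ) ξ :=
    differentiableAt_firstOrderField hXd
      (fun i j => differentiableAt_varTensor (hX2 ξ hξ) (h0 ξ hξ) hr2 i j) hrd hφ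
  have hd2 : DifferentiableAt ℝ (firstOrderField X (varTensorNormal X h) ρ φ) ξ :=
    differentiableAt_firstOrderField hXd
      (fun i j => differentiableAt_varTensorNormal (hX3 ξ hξ) (h0 ξ hξ) (hh2 ξ hξ) i j) hrd hφ
  rw [jac_smul_DSdot (hX2 ξ hξ) (h0 ξ hξ) hd1, jac_smul_DSdot (hX2 ξ hξ) (h0 ξ hξ) hd2]
  refine Finset.sum_congr rfl fun α _ => pd_congr ?_ α
  filter_upwards [hU.mem_nhds hξ] with η hη
  have ht := inner_scaledGrad_unitNormal X η α
  rw [inner_E3] at ht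
  have hA := varTensor_normal (hX2 η hη) (h0 η hη) ((hh2 η hη).differentiableAt (by norm_num))
    (hr η hη)
  funext l
  simp only [Finset.sum_apply, Pi.smul_apply, firstOrderField, hA, smul_add,
    Finset.sum_add_distrib, smul_smul, ← Finset.sum_smul]
  congr 2
  simp only [Matrix.sub_apply, Matrix.vecMulVec_apply, Fin.sum_univ_three]
  linear_combination -(gradS X h η l) * ht

end DeformableSurface

end

open DeformableSurface in
theorem mainTheorem2 {Sig : Set E3} {n : E3 → E3} :
    -- variation of the normal and of the contour normal line element
    (∀ (U : Set P2) (X : P2 → E3) (ρ : E3 → E3), IsLocalParam 1 Sig n U X →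
      ContDiffOn ℝ 1 (ρ ∘ X) U →
      (∀ ξ ∈ U, HasDerivAt (fun ε : ℝ => unitNormal (displace X ρ ε) ξ)
        (-WithLp.toLp 2 (gradSVec X (ρ ∘ X) ξ *ᵥ (unitNormal X ξ).ofLp)) 0) ∧
      (∀ (c : ℝ → P2) (s : ℝ), c s ∈ U → DifferentiableAt ℝ c s → deriv c s ≠ 0 →
        HasDerivAt (fun ε : ℝ => normalLineElement (displace X ρ ε) c s)
          (WithLp.toLp 2 ((normalLineElement X c s).ofLp ᵥ* varTensor X (ρ ∘ X) (c s))) 0)) ∧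
    -- variation of the integral of `D_S φ` over a patch
    (∀ (S : Patch Sig n) {F : Type*} [NormedAddCommGroup F] [NormedSpace ℝ F] [CompleteSpace F]
      (W : Set E3) (φ : E3 → F), IsOpen W → closure S.carrier ⊆ W → ContDiffOn ℝ 2 φ W →
      (∀ ρ : E3 → E3, (∀ k, ContDiffOn ℝ 2 (ρ ∘ S.X k) (S.U k)) →
        (∀ᶠ ε : ℝ in 𝓝 0, S.SurfIntegrable (fun k => displace (S.X k) ρ ε)
          (S.displacedDS ρ φ ε)) ∧
        S.SurfIntegrable S.X (fun k => DSdot (S.X k)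
          (firstOrderField (S.X k) (varTensor (S.X k) (ρ ∘ S.X k)) ρ φ)) ∧
        HasDerivAt
          (fun ε : ℝ => S.surfIntegral (fun k => displace (S.X k) ρ ε) (S.displacedDS ρ φ ε))
          (S.surfIntegral S.X (fun k => DSdot (S.X k)
            (firstOrderField (S.X k) (varTensor (S.X k) (ρ ∘ S.X k)) ρ φ))) 0) ∧
      -- the case of a displacement `h n` in the normal direction
      (∀ h : E3 → ℝ, (∀ k, ContDiffOn ℝ 3 (S.X k) (S.U k)) →
        (∀ k, ContDiffOn ℝ 2 (h ∘ S.X k) (S.U k)) →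
        S.SurfIntegrable S.X (fun k => DSdot (S.X k)
          (firstOrderField (S.X k) (varTensorNormal (S.X k) (h ∘ S.X k))
            (fun x => h x • n x) φ)) ∧
        HasDerivAt
          (fun ε : ℝ => S.surfIntegral (fun k => displace (S.X k) (fun x => h x • n x) ε)
            (S.displacedDS (fun x => h x • n x) φ ε))
          (S.surfIntegral S.X (fun k => DSdot (S.X k)
            (firstOrderField (S.X k) (varTensorNormal (S.X k) (h ∘ S.X k))
              (fun x => h x • n x) φ))) 0)) := by
  refine ⟨fun U X ρ hX hρ => ?_, fun S F _ _ _ W φ hW hSW hφ => ?_⟩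
  · have hXd : ∀ ξ ∈ U, DifferentiableAt ℝ X ξ := fun ξ hξ =>
      (hX.contDiffOn.contDiffAt (hX.isOpen_dom.mem_nhds hξ)).differentiableAt (by norm_num)
    have hρd : ∀ ξ ∈ U, DifferentiableAt ℝ (ρ ∘ X) ξ := fun ξ hξ =>
      (hρ.contDiffAt (hX.isOpen_dom.mem_nhds hξ)).differentiableAt (by norm_num)
    have hn : ∀ ξ ∈ U, ∀ ε : ℝ, unitNormal (displace X ρ ε) ξ
        = nu (pd X 0 ξ + ε • pd (ρ ∘ X) 0 ξ) (pd X 1 ξ + ε • pd (ρ ∘ X) 1 ξ) := fun ξ hξ ε => by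
      rw [← pd_displace (hXd ξ hξ) (hρd ξ hξ), ← pd_displace (hXd ξ hξ) (hρd ξ hξ)]; rfl
    refine ⟨fun ξ hξ => ?_, fun c s hs hc _ => ?_⟩
    · simp only [hn ξ hξ]
      exact hasDerivAt_nu_pd (areaVec_ne_zero (hX.immersion ξ hξ)) _
    · have hdisp : ∀ ε : ℝ, DifferentiableAt ℝ (displace X ρ ε) (c s) := fun ε =>
        (hXd _ hs).add ((hρd _ hs).const_smul ε)
      simp only [normalLineElement_eq, hn _ hs, deriv_comp_eq_sum (hdisp _) hc,
        deriv_comp_eq_sum (hXd _ hs) hc, pd_displace (hXd _ hs) (hρd _ hs)]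
      exact hasDerivAt_cross_nu (areaVec_ne_zero (hX.immersion _ hs)) _ _
  · have h0 : ∀ k, ∀ ξ ∈ S.U k, areaVec (S.X k) ξ ≠ 0 := fun k ξ hξ =>
      areaVec_ne_zero ((S.isLocalParam k).immersion ξ hξ)
    have hCW : ∀ k, ∀ ξ ∈ closure (S.K k), S.X k ξ ∈ W := fun k ξ hξ => by
      have hc : ContinuousWithinAt (S.X k) (S.K k) ξ :=
        (((S.isLocalParam k).contDiffOn.continuousOn).continuousAt
          ((S.isLocalParam k).isOpen_dom.mem_nhds (S.closure_subset k hξ))).continuousWithinAt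
      exact hSW (closure_mono (Set.subset_iUnion (fun k => S.X k '' S.K k) k)
        (hc.mem_closure_image hξ))
    have key := fun (ρ : E3 → E3) (hρ : ∀ k, ContDiffOn ℝ 2 (ρ ∘ S.X k) (S.U k)) k =>
      variation_piece (S.isLocalParam k).isOpen_dom (S.isLocalParam k).contDiffOn (h0 k) (hρ k)
        (S.isCompact_closure k) (S.closure_subset k) (S.measurable k) subset_closure hW hφ (hCW k)
    refine ⟨fun ρ hρ => ⟨Filter.eventually_all.mpr fun k => (key ρ hρ k).1,
      fun k => (key ρ hρ k).2.1, HasDerivAt.fun_sum fun k _ => (key ρ hρ k).2.2⟩,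
      fun h hX3 hh => ?_⟩
    have hnX : ∀ k, ∀ η ∈ S.U k,
        h (S.X k η) • n (S.X k η) = (h ∘ S.X k) η • unitNormal (S.X k) η := fun k η hη => by
      rw [(S.isLocalParam k).normal_eq η hη]; rfl
    have hρ : ∀ k, ContDiffOn ℝ 2 ((fun x => h x • n x) ∘ S.X k) (S.U k) := fun k => by
      have hn : ContDiffOn ℝ 2 (unitNormal (S.X k)) (S.U k) := fun η hη =>
        (contDiffAt_unitNormal ((hX3 k).contDiffAt ((S.isLocalParam k).isOpen_dom.mem_nhds hη))
          (by norm_num) (h0 k η hη)).contDiffWithinAt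
      exact ((hh k).smul hn).congr (hnX k)
    have heq : ∀ k, ∀ ξ ∈ S.K k, _ := fun k ξ hξ =>
      have hξC := subset_closure hξ
      jac_smul_DSdot_normal (ρ := fun x => h x • n x) (φ := φ) (S.isLocalParam k).isOpen_dom
        (S.closure_subset k hξC) (hX3 k) (h0 k) (hh k) (hnX k)
        (hφ.contDiffAt (hW.mem_nhds (hCW k ξ hξC)))
    refine ⟨fun k => (key _ hρ k).2.1.congr_fun (heq k) (S.measurable k), ?_⟩
    refine (HasDerivAt.fun_sum fun k _ => (key _ hρ k).2.2).congr_deriv ?_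
    exact Finset.sum_congr rfl fun k _ =>
      MeasureTheory.setIntegral_congr_fun (S.measurable k) (heq k)
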